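/- **Setting.** Let $d,k\ge 0$ be integers, let $\Theta_0\subseteq\mathbb{R}^d$ be open, let $\nu$ be a $\sigma$-finite measure on a measurable space $\mathcal{X}$, and let $\{P_\theta:\theta\in\Theta_0\}$ be probability measures on $\mathcal{X}$ that are absolutely continuous with respect to $\nu$, with densities $dP_\theta=dP_\theta/d\nu$. Assume that the model is Hellinger differentiable at every $t\in\Theta_0$: there is $\dot\xi_t:\mathcal X\to\mathbb{R}^d$, square integrable with respect to $\nu$, with $$\int\big[dP_{t+h}^{1/2}-dP_t^{1/2}-h^\top\dot\xi_t\big]^2\,d\nu=o(\|h\|_2^2)\qquad(h\to 0),$$ and put $\mathcal{I}(t):=4\int\dot\xi_t\dot\xi_t^\top\,d\nu$. Let $\|\cdot\|$ be any norm on $\mathbb{R}^k$ and $\|u\|_*:=\sup\{u^\top x:\|x\|\le 1\}$ its dual norm. Let $\psi:\Theta_0\to\mathbb{R}^k$ be Lebesgue measurable. A real function on $\Theta_0$ is called absolutely continuous if its restriction to every closed line segment contained in $\Theta_0$ is absolutely continuous as a function of one variable; a vector-valued function is absolutely continuous if each of its coordinates is. Let $\phi:\Theta_0\to\mathbb{R}^k$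 be absolutely continuous, with almost-everywhere derivative $\nabla\phi=(\partial\phi_j/\partial\theta_i)_{i\le d,\,j\le k}$ (a $d\times k$ matrix). **Nice priors.** Let $\mathcal{Q}^\dagger$ be the set of probability measures $Q$ on $\Theta_0$ such that 1. $Q$ has an absolutely continuous Lebesgue density $q\ge 0$ on $\Theta_0$, and its Fisher information $\mathcal{I}(Q):=\int_{\Theta_0}\frac{\nabla q\,\nabla q^\top}{q}\mathbf 1\{q>0\}\,dt$ is finite and positive definite; 2. $\int\|\phi\|\,dQ<\infty$, $\int\|\nabla\phi\|\,dQ<\infty$ and $\int\operatorname{tr}\mathcal{I}(t)\,dQ(t)<\infty$; 3. $q(\theta)\to 0$ whenever $\theta\in\Theta_0$ tends to a (finite) boundary point of $\Theta_0$ along a line parallel to a coordinate axis. For $Q\in\mathcal{Q}^\dagger$ put $$\Gamma_{Q,\phi}:=\Big(\int_{\Theta_0}\nabla\phi\,dQ\Big)^\top\Big(\mathcal{I}(Q)+\int_{\Theta_0}\mathcal{I}(t)\,dQ(t)\Big)^{-1}\Big(\int_{\Theta_0}\nabla\phi\,dQ\Big).$$ **Theorem.** With the infimum taken over all measurable $T:\mathcal{X}\to\mathbb{R}^k$,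 $$\inf_T\,\sup_{\theta\in\Theta_0}\mathbb{E}_{\theta}\|T(X)-\psi(\theta)\|^2\;\ge\;\sup_{Q\in\mathcal{Q}^\dagger}\Big[\sup_{\|u\|_*\le 1}\big\|\Gamma_{Q,\phi}^{1/2}u\big\|_2-\Big(\int\|\psi(\theta)-\phi(\theta)\|^2\,dQ(\theta)\Big)^{1/2}\Big]_+^2 ,$$ where $\|\cdot\|_2$ is the Euclidean norm and $[x]_+=\max(x,0)$. Expectations and integrals of nonnegative functions may be $+\infty$, with $[x-\infty]_+=0$ and a supremum over the empty set equal to $0$. -/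

import Mathlib

open MeasureTheory Filter Topology Asymptotics
open scoped Matrix MatrixOrder ENNReal

namespace SurrogateVanTrees

noncomputable section

/-- The Euclidean space `ℝⁿ`. -/
abbrev Vec (n : ℕ) : Type := EuclideanSpace ℝ (Fin n)

/-- The `i`-th canonical basis vector of `ℝᵈ`. -/
def basisVec {d : ℕ} (i : Fin d) : Vec d := EuclideanSpace.single i (1 : ℝ)

/-- The norm dual to a norm `N` on `ℝᵏ`: `‖u‖_* = sup {⟨u, x⟩ : N x ≤ 1}`. -/
def dualNorm {k : ℕ} (N : Seminorm ℝ (Vec k)) (u : Vec k) : ℝ :=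
  sSup {r : ℝ | ∃ x : Vec k, N x ≤ 1 ∧ r = inner ℝ u x}

/-- The square root `(dP_θ / dν)^{1/2}` of the density of `P_θ` with respect to `ν`. -/
def sqrtDensity {d : ℕ} {𝓧 : Type*} [MeasurableSpace 𝓧] (P : Vec d → Measure 𝓧) (ν : Measure 𝓧)
    (θ : Vec d) (x : 𝓧) : ℝ :=
  Real.sqrt ((P θ).rnDeriv ν x).toReal

/-- The path `h ↦ P_{t+h}` is Hellinger differentiable at `h = 0` with derivative `ξ`:
`ξ` is square integrable with respect to `ν` and
`∫ [dP_{t+h}^{1/2} - dP_t^{1/2} - hᵀ ξ]² dν = o(‖h‖²)` as `h → 0`. -/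
def HasHellingerDerivAt {d : ℕ} {𝓧 : Type*} [MeasurableSpace 𝓧] (P : Vec d → Measure 𝓧)
    (ν : Measure 𝓧) (t : Vec d) (ξ : 𝓧 → Vec d) : Prop :=
  MemLp ξ 2 ν ∧
    (fun h : Vec d =>
      ∫ x, (sqrtDensity P ν (t + h) x - sqrtDensity P ν t x - inner ℝ h (ξ x)) ^ 2 ∂ν)
      =o[𝓝 0] fun h : Vec d => ‖h‖ ^ 2

/-- The Fisher information `4 ∫ ξ ξᵀ dν` of a model with Hellinger derivative `ξ`. -/
def fisherInfo {d : ℕ} {𝓧 : Type*} [MeasurableSpace 𝓧] (ν : Measure 𝓧) (ξ : 𝓧 → Vec d) :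
    Matrix (Fin d) (Fin d) ℝ :=
  Matrix.of fun i j => 4 * ∫ x, ξ x i * ξ x j ∂ν

/-- Absolute continuity of `f` on an open set `Θ₀ ⊆ ℝᵈ`: along every closed line segment contained
in `Θ₀` (in whatever direction), `f` is an absolutely continuous function of one variable. -/
def IsAbsCont {d : ℕ} (Θ₀ : Set (Vec d)) (f : Vec d → ℝ) : Prop :=
  ∀ x y : Vec d, segment ℝ x y ⊆ Θ₀ →
    AbsolutelyContinuousOnInterval (fun s : ℝ => f (AffineMap.lineMap x y s)) 0 1

/-- The partial derivative `∂f/∂θ_i`. -/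
def partialDeriv {d : ℕ} (f : Vec d → ℝ) (i : Fin d) (t : Vec d) : ℝ :=
  lineDeriv ℝ f t (basisVec i)

/-- The `d × k` matrix `∇φ(t)`, with entries `∂φ_j/∂θ_i`. -/
def gradMatrix {d k : ℕ} (φ : Vec d → Vec k) (t : Vec d) : Matrix (Fin d) (Fin k) ℝ :=
  Matrix.of fun i j => partialDeriv (fun s => φ s j) i t

/-- The `i`-th coordinate of `∇q(t) / q(t)^{1/2} · 1{q(t) > 0}`. -/
def rootScore {d : ℕ} (q : Vec d → ℝ) (i : Fin d) (t : Vec d) : ℝ :=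
  open scoped Classical in if 0 < q t then partialDeriv q i t / Real.sqrt (q t) else 0

/-- The Fisher information `𝓘(Q) = ∫_{Θ₀} (∇q ∇qᵀ / q) 1{q > 0} dt` of a prior with
Lebesgue density `q` on `Θ₀`. -/
def priorFisherInfo {d : ℕ} (Θ₀ : Set (Vec d)) (q : Vec d → ℝ) : Matrix (Fin d) (Fin d) ℝ :=
  open scoped Classical in
  Matrix.of fun i j =>
    ∫ t in Θ₀, if 0 < q t then partialDeriv q i t * partialDeriv q j t / q t else 0

/-- `Q` is a "nice" prior on `Θ₀` with absolutely continuous Lebesgue density `q`, relative to the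
Fisher information `I` of the model and to the surrogate `φ`. -/
structure IsNicePrior {d k : ℕ} (Θ₀ : Set (Vec d)) (I : Vec d → Matrix (Fin d) (Fin d) ℝ)
    (φ : Vec d → Vec k) (Q : Measure (Vec d)) (q : Vec d → ℝ) : Prop where
  isProbabilityMeasure : IsProbabilityMeasure Q
  aemeasurable_density : AEMeasurable q (volume.restrict Θ₀)
  density_nonneg : ∀ t ∈ Θ₀, 0 ≤ q t
  eq_withDensity : Q = (volume.restrict Θ₀).withDensity fun t => ENNReal.ofReal (q t)
  absCont_density : IsAbsCont Θ₀ q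
  /-- The integrals defining `𝓘(Q)` converge, i.e. `∇q / q^{1/2}` is square integrable. -/
  memLp_rootScore : ∀ i, MemLp (rootScore q i) 2 (volume.restrict Θ₀)
  posDef_priorFisherInfo : (priorFisherInfo Θ₀ q).PosDef
  integrable_surrogate : Integrable φ Q
  integrable_gradMatrix : ∀ i j, Integrable (fun t => gradMatrix φ t i j) Q
  integrable_trace : Integrable (fun t => (I t).trace) Q
  /-- `q(θ) → 0` as `θ ∈ Θ₀` tends to a boundary point of `Θ₀` along a line parallel to a
  coordinate axis. -/
  tendsto_boundary : ∀ b ∈ frontier Θ₀, ∀ i : Fin d,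
    Tendsto (fun s : ℝ => q (b + s • basisVec i)) (𝓝[{s : ℝ | b + s • basisVec i ∈ Θ₀}] 0) (𝓝 0)

/-- `∫ ∇φ dQ`, entrywise. -/
def meanGrad {d k : ℕ} (φ : Vec d → Vec k) (Q : Measure (Vec d)) : Matrix (Fin d) (Fin k) ℝ :=
  Matrix.of fun i j => ∫ t, gradMatrix φ t i j ∂Q

/-- `∫ I(t) dQ`, entrywise. -/
def meanInfo {d : ℕ} (I : Vec d → Matrix (Fin d) (Fin d) ℝ) (Q : Measure (Vec d)) :
    Matrix (Fin d) (Fin d) ℝ :=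
  Matrix.of fun i j => ∫ t, I t i j ∂Q

/-- `Γ_{Q,φ} = (∫ ∇φ dQ)ᵀ (𝓘(Q) + ∫ I(t) dQ)⁻¹ (∫ ∇φ dQ)`, where `q` is the density of `Q`. -/
def vanTreesMatrix {d k : ℕ} (Θ₀ : Set (Vec d)) (I : Vec d → Matrix (Fin d) (Fin d) ℝ)
    (φ : Vec d → Vec k) (Q : Measure (Vec d)) (q : Vec d → ℝ) : Matrix (Fin k) (Fin k) ℝ :=
  (meanGrad φ Q)ᵀ * (priorFisherInfo Θ₀ q + meanInfo I Q)⁻¹ * meanGrad φ Q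

/-- `sup_{‖u‖_* ≤ 1} ‖Γ^{1/2} u‖₂`, with the Euclidean norm of `Γ^{1/2} u` and the norm `‖·‖_*` dual
to `N`. -/
def surrogateEfficiency {k : ℕ} (N : Seminorm ℝ (Vec k)) (Γ : Matrix (Fin k) (Fin k) ℝ) : ℝ≥0∞ :=
  ⨆ (u : Vec k) (_ : dualNorm N u ≤ 1),
    ENNReal.ofReal ‖(WithLp.toLp 2 (CFC.sqrt Γ *ᵥ u.ofLp) : Vec k)‖

/-- `(∫ N(ψ - φ)² dQ)^{1/2}`, possibly infinite. -/
def approxBias {d k : ℕ} (N : Seminorm ℝ (Vec k)) (ψ φ : Vec d → Vec k) (Q : Measure (Vec d)) :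
    ℝ≥0∞ :=
  (∫⁻ t, ENNReal.ofReal (N (ψ t - φ t) ^ 2) ∂Q) ^ (1 / 2 : ℝ)

/-- The minimax risk `inf_T sup_{θ ∈ Θ₀} E_θ N(T(X) - ψ(θ))²` over all measurable estimators `T`,
possibly infinite. -/
def minimaxRisk {d k : ℕ} {𝓧 : Type*} [MeasurableSpace 𝓧] (P : Vec d → Measure 𝓧)
    (Θ₀ : Set (Vec d)) (N : Seminorm ℝ (Vec k)) (ψ : Vec d → Vec k) : ℝ≥0∞ :=
  ⨅ (T : 𝓧 → Vec k) (_ : Measurable T),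
    ⨆ θ ∈ Θ₀, ∫⁻ x, ENNReal.ofReal (N (T x - ψ θ) ^ 2) ∂(P θ)

end

end SurrogateVanTrees

/-! ### Absolutely continuous functions of one variable. -/

namespace SurrogateVanTrees

/-! This is the van Trees inequality, applied to the surrogate `φ` instead of `ψ`. Fix an estimator
`T` of finite maximal risk `R`, a nice prior of finite approximation bias `b`, and `u` in the dual
unit ball. Put `S = uᵀT`, `g = uᵀφ`, `m(t) = E_t S`. Since `q` vanishes at the boundary, `∂ᵢ((m - g)
q)` integrates to zero, so `w = (∫∇φ dQ) u` has coordinates `∫ (∂ᵢm) q + (m - g) ∂ᵢq`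
(`integral_partialDeriv_eq`, `integral_biasFlux_inner`).

This integrand is the inner product in `L²(ν)` of `(S - g) √(p_t q)` with the joint score `2 ξᵢ √q +
√p_t ∂ᵢq/√q`, where `p_t` is the density of `P_t`. The two halves of the score are orthogonal
because `√p_t` is orthogonal to `ξ`. Expanding a square for each `t` and integrating gives `2 cᵀw ≤
V + cᵀJc` for all `c`, with `J = 𝓘(Q) + ∫ I dQ` and `V` the Bayes risk of `S` for `g`
(`two_mul_dotProduct_le`). The choice `c = J⁻¹w` yields `‖Γ^{1/2}u‖² = wᵀJ⁻¹w ≤ V`, while `|uᵀx| ≤ N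
x` and Minkowski's inequality give `V ≤ (√R + b)²`. Working for fixed `t` avoids any joint
measurability in `(x, t)`.

Two points need care. First, `m` must be differentiable along lines although `S` is unbounded: a
bounded risk forces locally bounded second moments (`eventually_integral_sq_le`), so with `a_s` the
square root of the density at `t + s v`, `S (a_s - a_0)` tends weakly to zero, and this suffices to
differentiate `∫ S a_s²` (`hasDerivAt_integral_mul_sq`). Second, only `m' q` is known to be
integrable, not `m'`, so `m` need not be absolutely continuous where `q` vanishes. Replacing `q` by
`(q - ε)₊` removes neighbourhoods of the zeros of `q` and of the boundary; elsewhere `1/q` is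
locally bounded. Then `ε → 0` by dominated convergence (`integral_line_eq_zero`), and Fubini passes
from lines to `ℝᵈ`. -/

theorem _root_.AbsolutelyContinuousOnInterval.of_dist_le {f g : ℝ → ℝ} {a b : ℝ}
    (hf : AbsolutelyContinuousOnInterval f a b) (h : ∀ x y, dist (g x) (g y) ≤ dist (f x) (f y)) :
    AbsolutelyContinuousOnInterval g a b :=
  squeeze_zero (fun _ => Finset.sum_nonneg fun _ _ => dist_nonneg)
    (fun _ => Finset.sum_le_sum fun _ _ => h _ _) hf

theorem _root_.AbsolutelyContinuousOnInterval.congr {f g : ℝ → ℝ} {a b : ℝ}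
    (hf : AbsolutelyContinuousOnInterval f a b) (h : Set.EqOn f g (Set.uIcc a b)) :
    AbsolutelyContinuousOnInterval g a b := by
  rw [absolutelyContinuousOnInterval_iff] at hf ⊢
  intro ε hε
  obtain ⟨δ, hδ, H⟩ := hf ε hε
  refine ⟨δ, hδ, fun E hE hlt => ?_⟩
  convert! H E hE hlt using 1
  refine Finset.sum_congr rfl fun i hi => ?_
  rw [h (hE.1 i hi).1, h (hE.1 i hi).2]

/-- A function with an everywhere defined integrable derivative is absolutely continuous. -/
theorem absolutelyContinuousOnInterval_of_hasDerivAt {f f' : ℝ → ℝ} {a b : ℝ}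
    (hf : ∀ x ∈ Set.uIcc a b, HasDerivAt f (f' x) x) (hf' : IntervalIntegrable f' volume a b) :
    AbsolutelyContinuousOnInterval f a b := by
  have h1 := hf'.absolutelyContinuousOnInterval_intervalIntegral (c := a) Set.left_mem_uIcc
  have h2 : AbsolutelyContinuousOnInterval (fun _ : ℝ => f a) a b := by
    rw [absolutelyContinuousOnInterval_iff]
    exact fun ε hε => ⟨1, one_pos, fun E _ _ => by simpa using hε⟩
  refine (h1.add h2).congr fun x hx => ?_
  have h3 := intervalIntegral.integral_eq_sub_of_hasDerivAt (a := a) (b := x) (f := f) (f' := f')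
    (fun y hy => hf y (Set.uIcc_subset_uIcc_left hx hy))
    (hf'.mono_set (Set.uIcc_subset_uIcc_left hx))
  simp [h3]

/-- A function which is integrable, and locally the integral of an integrable function, has a
derivative of integral zero. -/
theorem integral_eq_zero_of_locally_integral {G G' : ℝ → ℝ} (hG : Integrable G)
    (hG' : Integrable G')
    (h : ∀ x, ∀ᶠ y in 𝓝 x, G y - G x = ∫ s in x..y, G' s) : ∫ s, G' s = 0 := by
  have hint : ∀ a b, IntervalIntegrable G' volume a b := fun a b => hG'.intervalIntegrable
  have hloc : IsLocallyConstant fun y => G y - ∫ s in (0 : ℝ)..y, G' s := by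
    rw [IsLocallyConstant.iff_eventually_eq]
    intro x
    filter_upwards [h x] with y hy
    have := intervalIntegral.integral_add_adjacent_intervals (hint 0 x) (hint x y)
    linarith
  have hconst : ∀ y, G y = G 0 + ∫ s in (0 : ℝ)..y, G' s := by
    intro y
    have := hloc.apply_eq_of_isPreconnected isPreconnected_univ (Set.mem_univ y)
      (Set.mem_univ (0 : ℝ))
    simp only [intervalIntegral.integral_same, sub_zero] at this
    linarith
  have htop : Tendsto G atTop (𝓝 (G 0 + ∫ s in Set.Ioi 0, G' s)) := by
    have := (intervalIntegral_tendsto_integral_Ioi 0 hG'.integrableOn tendsto_id).const_add (G 0)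
    exact this.congr fun y => (hconst y).symm
  have hbot : Tendsto G atBot (𝓝 (G 0 - ∫ s in Set.Iic 0, G' s)) := by
    have := (intervalIntegral_tendsto_integral_Iic 0 hG'.integrableOn tendsto_id).const_sub (G 0)
    refine this.congr fun y => ?_
    rw [hconst y, intervalIntegral.integral_symm y 0, sub_eq_add_neg, id]
  -- An integrable function that has a limit at infinity has limit zero, as every neighbourhood of
  -- infinity has infinite measure.
  have e1 : G 0 + ∫ s in Set.Ioi 0, G' s = 0 :=
    (hG.integrableAtFilter atTop).eq_zero_of_tendsto (by
      intro s hs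
      obtain ⟨a, ha⟩ := mem_atTop_sets.1 hs
      exact top_le_iff.1 (by
        rw [← Real.volume_Ici (a := a)]
        exact measure_mono fun y hy => ha y hy)) htop
  have e2 : G 0 - ∫ s in Set.Iic 0, G' s = 0 :=
    (hG.integrableAtFilter atBot).eq_zero_of_tendsto (by
      intro s hs
      obtain ⟨a, ha⟩ := mem_atBot_sets.1 hs
      exact top_le_iff.1 (by
        rw [← Real.volume_Iic (a := a)]
        exact measure_mono fun y hy => ha y hy)) hbot
  have e3 := intervalIntegral.integral_Iic_add_Ioi (b := (0 : ℝ)) (f := G') (μ := volume)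
    hG'.integrableOn hG'.integrableOn
  linarith

theorem max_sub_dist_le (q : ℝ → ℝ) (ε x y : ℝ) :
    dist (max (q x - ε) 0) (max (q y - ε) 0) ≤ dist (q x) (q y) := by
  rw [Real.dist_eq, Real.dist_eq]
  have := abs_max_sub_max_le_abs (q x - ε) (q y - ε) 0
  simpa using this

/-! ### Integration by parts on open subsets of the line. -/

section Line

variable {U : Set ℝ} {m m' g q : ℝ → ℝ}

theorem exists_Icc_subset_of_isOpen {W : Set ℝ} (hW : IsOpen W) {x : ℝ} (hx : x ∈ W) :
    ∃ δ > 0, Set.Icc (x - δ) (x + δ) ⊆ W := by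
  obtain ⟨δ, hδ, h⟩ := Metric.nhds_basis_closedBall.mem_iff.1 (hW.mem_nhds hx)
  exact ⟨δ, hδ, by rwa [Real.closedBall_eq_Icc] at h⟩

theorem continuousOn_of_absCont (hU : IsOpen U)
    (hq : ∀ a b, Set.uIcc a b ⊆ U → AbsolutelyContinuousOnInterval q a b) : ContinuousOn q U := by
  intro x hx
  obtain ⟨δ, hδ, h⟩ := exists_Icc_subset_of_isOpen hU hx
  have hle : x - δ ≤ x + δ := by linarith
  have := (hq (x - δ) (x + δ) (by rwa [Set.uIcc_of_le hle])).continuousOn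
  rw [Set.uIcc_of_le hle] at this
  exact (this.continuousAt (Icc_mem_nhds (by linarith) (by linarith))).continuousWithinAt

/-- The local fundamental theorem of calculus for `(m - g) (q - ε)₊`, where `q > 0`. -/
theorem truncated_sub_eq_integral {ε a b : ℝ} (hU : IsOpen U) (hab : Set.uIcc a b ⊆ U)
    (hpos : ∀ x ∈ Set.uIcc a b, 0 < q x) (hqc : ContinuousOn q U)
    (hq : AbsolutelyContinuousOnInterval q a b)
    (hg : AbsolutelyContinuousOnInterval g a b) (hm : ∀ x ∈ U, HasDerivAt m (m' x) x)
    (hm' : IntegrableOn (fun x => m' x * q x) U) :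
    (m b - g b) * max (q b - ε) 0 - (m a - g a) * max (q a - ε) 0 =
      ∫ x in a..b, {x | x ∈ U ∧ ε < q x}.indicator
        (fun x => (m' x - deriv g x) * (q x - ε) + (m x - g x) * deriv q x) x := by
  have hqc' : ContinuousOn q (Set.uIcc a b) := hqc.mono hab
  -- On this compact interval `q` is continuous and positive, so `1/q` is bounded and `m' = (m'
  -- q)/q` is integrable.
  have hm'I : IntervalIntegrable m' volume a b := by
    have h1 : IntervalIntegrable (fun x => m' x * q x) volume a b :=
      (hm'.mono_set hab).intervalIntegrable
    have h2 := h1.mul_continuousOn (hqc'.inv₀ fun x hx => (hpos x hx).ne')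
    refine h2.congr fun x hx => ?_
    have := (hpos x (Set.uIoc_subset_uIcc hx)).ne'
    simp only [Pi.inv_apply]
    field_simp
  have hmac := absolutelyContinuousOnInterval_of_hasDerivAt (fun x hx => hm x (hab hx)) hm'I
  have hp : AbsolutelyContinuousOnInterval (fun x => max (q x - ε) 0) a b :=
    hq.of_dist_le (max_sub_dist_le q ε)
  refine ((hmac.sub hg).integral_deriv_mul_eq_sub hp).symm.trans ?_
  refine intervalIntegral.integral_congr_ae ?_
  filter_upwards [hg.ae_differentiableAt] with x hgx hx
  have hxI := Set.uIoc_subset_uIcc hx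
  have hd : deriv (m - g) x = m' x - deriv g x := ((hm x (hab hxI)).sub (hgx hxI).hasDerivAt).deriv
  rw [hd]
  by_cases hqx : ε < q x
  · have hev : (fun x => max (q x - ε) 0) =ᶠ[𝓝 x] fun x => q x - ε := by
      have := (hqc.continuousAt (hU.mem_nhds (hab hxI))).eventually (lt_mem_nhds hqx)
      filter_upwards [this] with y hy
      exact max_eq_left (by linarith)
    rw [Set.indicator_of_mem (show x ∈ {x | x ∈ U ∧ ε < q x} from ⟨hab hxI, hqx⟩), hev.deriv_eq,
      deriv_sub_const, max_eq_left (by linarith)]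
    rfl
  -- Where `q ≤ ε` the truncation attains its minimum 0, so its `deriv` is 0; this includes the
  -- points `q x = ε`, where it may fail to be differentiable.
  · have hmin : IsLocalMin (fun x => max (q x - ε) 0) x :=
      Eventually.of_forall fun y => by
        beta_reduce
        rw [max_eq_right (show q x - ε ≤ 0 by linarith)]
        exact le_max_right _ _
    rw [Set.indicator_of_notMem (fun h => hqx h.2), hmin.deriv_eq_zero,
      max_eq_right (by linarith)]
    simp

/-- Extended by zero, `(m - g) (q - ε)₊` is locally an integral on the whole line: the fundamental
theorem applies near points of `U` with `q > 0`, and the function vanishes identically near every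
other point. No description of the components of `U` is needed. -/
theorem integral_truncated_eq_zero {ε : ℝ} (hε : 0 < ε) (hU : IsOpen U)
    (hq : ∀ a b, Set.uIcc a b ⊆ U → AbsolutelyContinuousOnInterval q a b)
    (hg : ∀ a b, Set.uIcc a b ⊆ U → AbsolutelyContinuousOnInterval g a b)
    (hm : ∀ x ∈ U, HasDerivAt m (m' x) x)
    (hlim : ∀ b ∈ frontier U, Tendsto q (𝓝[U] b) (𝓝 0))
    (hm'q : IntegrableOn (fun x => m' x * q x) U)
    (hmgq : IntegrableOn (fun x => (m x - g x) * q x) U)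
    (hint : Integrable ({x | x ∈ U ∧ ε < q x}.indicator
        (fun x => (m' x - deriv g x) * (q x - ε) + (m x - g x) * deriv q x))) :
    ∫ x, {x | x ∈ U ∧ ε < q x}.indicator
        (fun x => (m' x - deriv g x) * (q x - ε) + (m x - g x) * deriv q x) x = 0 := by
  have hqc := continuousOn_of_absCont hU hq
  have hgc := continuousOn_of_absCont hU hg
  have hmc : ContinuousOn m U := fun x hx => (hm x hx).continuousAt.continuousWithinAt
  have hG : Integrable (U.indicator fun x => (m x - g x) * max (q x - ε) 0) := by
    rw [integrable_indicator_iff hU.measurableSet]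
    refine Integrable.mono hmgq (((hmc.sub hgc).mul
      ((hqc.sub continuousOn_const).sup continuousOn_const)).aestronglyMeasurable
        hU.measurableSet) (Eventually.of_forall fun x => ?_)
    rw [norm_mul, norm_mul]
    gcongr
    rw [Real.norm_eq_abs, Real.norm_eq_abs, abs_of_nonneg (le_max_right _ _)]
    exact max_le (by linarith [le_abs_self (q x)]) (abs_nonneg _)
  refine integral_eq_zero_of_locally_integral hG hint fun x => ?_
  -- The split is at `0 < q x`, not at `ε < q x`: near a point with `q x = ε` the truncated function
  -- need not vanish, whereas near a zero of `q` it does.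
  by_cases hxU : x ∈ U ∧ 0 < q x
  · have hW : IsOpen (U ∩ q ⁻¹' Set.Ioi 0) := hqc.isOpen_inter_preimage hU isOpen_Ioi
    obtain ⟨δ, hδ, h⟩ := exists_Icc_subset_of_isOpen hW (x := x) hxU
    filter_upwards [Icc_mem_nhds (show x - δ < x by linarith) (show x < x + δ by linarith)]
      with y hy
    have hsub : Set.uIcc x y ⊆ U ∩ q ⁻¹' Set.Ioi 0 :=
      (Set.uIcc_subset_Icc ⟨by linarith, by linarith⟩ hy).trans h
    have hsubU : Set.uIcc x y ⊆ U := hsub.trans Set.inter_subset_left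
    rw [Set.indicator_of_mem (hsubU Set.right_mem_uIcc), Set.indicator_of_mem hxU.1]
    exact truncated_sub_eq_integral hU hsubU (fun z hz => (hsub hz).2) hqc
      (hq _ _ hsubU) (hg _ _ hsubU) hm hm'q
  · have hev : ∀ᶠ y in 𝓝 x, ¬ (y ∈ U ∧ ε < q y) := by
      by_cases hx : x ∈ U
      · have hqx : q x < ε := by
          have : ¬ 0 < q x := fun h => hxU ⟨hx, h⟩
          linarith
        filter_upwards [(hqc.continuousAt (hU.mem_nhds hx)).eventually (gt_mem_nhds hqx)] with y hy h
        linarith [h.2]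
      · by_cases hxc : x ∈ closure U
        · have hfr : x ∈ frontier U := ⟨hxc, by rwa [hU.interior_eq]⟩
          have := (hlim x hfr).eventually (gt_mem_nhds hε)
          filter_upwards [eventually_nhdsWithin_iff.1 this] with y hy h
          linarith [hy h.1, h.2]
        · filter_upwards [isClosed_closure.isOpen_compl.mem_nhds hxc] with y hy h
          exact hy (subset_closure h.1)
    obtain ⟨δ, hδ, hball⟩ := Metric.eventually_nhds_iff_ball.1 hev
    filter_upwards [Metric.ball_mem_nhds x hδ] with y hy
    have hz : ∀ z ∈ Metric.ball x δ, U.indicator (fun x => (m x - g x) * max (q x - ε) 0) z = 0 := by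
      intro z hz
      by_cases hzU : z ∈ U
      · have : ¬ ε < q z := fun h => hball z hz ⟨hzU, h⟩
        rw [Set.indicator_of_mem hzU, max_eq_right (by linarith), mul_zero]
      · rw [Set.indicator_of_notMem hzU]
    rw [hz y hy, hz x (Metric.mem_ball_self hδ), sub_zero]
    symm
    refine intervalIntegral.integral_zero_ae (Eventually.of_forall fun z hz' => ?_)
    refine Set.indicator_of_notMem (s := {x | x ∈ U ∧ ε < q x}) (hball z ?_) _
    have hconv := (convex_ball x δ).ordConnected
    exact hconv.uIcc_subset (Metric.mem_ball_self hδ) hy (Set.uIoc_subset_uIcc hz')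

/-- Integration by parts on an open subset of the line, for a density `q` which vanishes at the
boundary. -/
theorem integral_line_eq_zero (hU : IsOpen U) (hq0 : ∀ x ∈ U, 0 ≤ q x)
    (hq : ∀ a b, Set.uIcc a b ⊆ U → AbsolutelyContinuousOnInterval q a b)
    (hg : ∀ a b, Set.uIcc a b ⊆ U → AbsolutelyContinuousOnInterval g a b)
    (hm : ∀ x ∈ U, HasDerivAt m (m' x) x)
    (hlim : ∀ b ∈ frontier U, Tendsto q (𝓝[U] b) (𝓝 0))
    (hm'q : IntegrableOn (fun x => m' x * q x) U)
    (hg'q : IntegrableOn (fun x => deriv g x * q x) U)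
    (hmgq : IntegrableOn (fun x => (m x - g x) * q x) U)
    (hmgq' : IntegrableOn (fun x => (m x - g x) * deriv q x) U) :
    ∫ x in U, ((m' x - deriv g x) * q x + (m x - g x) * deriv q x) = 0 := by
  have hqc := continuousOn_of_absCont hU hq
  have hgc := continuousOn_of_absCont hU hg
  have hmc : ContinuousOn m U := fun x hx => (hm x hx).continuousAt.continuousWithinAt
  have hUm := hU.measurableSet
  set G' : ℝ → ℝ → ℝ := fun ε => {x | x ∈ U ∧ ε < q x}.indicator
        (fun x => (m' x - deriv g x) * (q x - ε) + (m x - g x) * deriv q x) with hG'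
  have hGin : ∀ ε x, x ∈ U → ε < q x →
      G' ε x = (m' x - deriv g x) * (q x - ε) + (m x - g x) * deriv q x := fun ε x h1 h2 =>
    Set.indicator_of_mem (s := {x | x ∈ U ∧ ε < q x}) ⟨h1, h2⟩ _
  have hGout : ∀ ε x, ¬ (x ∈ U ∧ ε < q x) → G' ε x = 0 := fun ε x h =>
    Set.indicator_of_notMem (s := {x | x ∈ U ∧ ε < q x}) h _
  have hW : ∀ ε, IsOpen {x | x ∈ U ∧ ε < q x} := fun ε =>
    hqc.isOpen_inter_preimage hU isOpen_Ioi
  set B : ℝ → ℝ := U.indicator fun x =>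
    ‖m' x * q x‖ + ‖deriv g x * q x‖ + ‖(m x - g x) * deriv q x‖ with hB
  have hBint : Integrable B := by
    rw [hB, integrable_indicator_iff hUm]
    exact (hm'q.norm.add hg'q.norm).add hmgq'.norm
  have hm'm : AEStronglyMeasurable m' (volume.restrict U) := by
    refine (measurable_deriv m).aestronglyMeasurable.congr ?_
    filter_upwards [ae_restrict_mem hUm] with x hx using (hm x hx).deriv
  have hmeas : ∀ ε, AEStronglyMeasurable (G' ε) volume := by
    intro ε
    rw [hG', aestronglyMeasurable_indicator_iff (hW ε).measurableSet]
    have hsub : {x | x ∈ U ∧ ε < q x} ⊆ U := fun x hx => hx.1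
    refine AEStronglyMeasurable.mono_measure ?_ (Measure.restrict_mono_set volume hsub)
    exact ((hm'm.sub (measurable_deriv g).aestronglyMeasurable).mul
      ((hqc.sub continuousOn_const).aestronglyMeasurable hUm)).add
      (((hmc.sub hgc).aestronglyMeasurable hUm).mul (measurable_deriv q).aestronglyMeasurable)
  have hbound : ∀ ε, 0 < ε → ∀ x, ‖G' ε x‖ ≤ B x := by
    intro ε hε x
    by_cases hx : x ∈ U ∧ ε < q x
    · rw [hGin ε x hx.1 hx.2, hB, Set.indicator_of_mem hx.1]
      refine (norm_add_le _ _).trans (add_le_add_left ?_ _)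
      rw [sub_mul]
      refine (norm_sub_le _ _).trans ?_
      have : ‖q x - ε‖ ≤ ‖q x‖ := by
        rw [Real.norm_eq_abs, Real.norm_eq_abs, abs_of_nonneg (by linarith [hx.2]),
          abs_of_nonneg (hq0 x hx.1)]
        linarith
      simp only [norm_mul]
      gcongr
    · rw [hGout ε x hx, norm_zero, hB]
      exact Set.indicator_nonneg (fun y _ => by positivity) x
  have hzero : ∀ n : ℕ, ∫ x, G' (1 / ((n : ℝ) + 1)) x = 0 := fun n =>
    integral_truncated_eq_zero Nat.one_div_pos_of_nat hU hq hg hm hlim hm'q hmgq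
      (hBint.mono' (hmeas _) (Eventually.of_forall (hbound _ Nat.one_div_pos_of_nat)))
  have hlimit : Tendsto (fun n : ℕ => ∫ x, G' (1 / ((n : ℝ) + 1)) x) atTop
      (𝓝 (∫ x, U.indicator (fun x => (m' x - deriv g x) * q x + (m x - g x) * deriv q x) x)) := by
    refine tendsto_integral_of_dominated_convergence B (fun n => hmeas _) hBint
      (fun n => Eventually.of_forall (hbound _ Nat.one_div_pos_of_nat))
      (Eventually.of_forall fun x => ?_)
    by_cases hxU : x ∈ U
    · rcases (hq0 x hxU).eq_or_lt with hx0 | hx0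
      -- At a zero of `q` the truncated integrands vanish for every `n`, and so does the limit,
      -- because `q` is minimal there and `deriv q x = 0`.
      · have hmin : IsLocalMin q x := by
          filter_upwards [hU.mem_nhds hxU] with y hy
          rw [← hx0]; exact hq0 y hy
        rw [Set.indicator_of_mem hxU, hmin.deriv_eq_zero, ← hx0]
        refine tendsto_const_nhds.congr fun n => ?_
        rw [hGout]
        · simp
        · rintro ⟨-, h⟩
          have : (0 : ℝ) < 1 / ((n : ℝ) + 1) := Nat.one_div_pos_of_nat
          linarith
      · rw [Set.indicator_of_mem hxU]
        have ht := tendsto_one_div_add_atTop_nhds_zero_nat (𝕜 := ℝ)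
        have h1 : Tendsto (fun n : ℕ => (m' x - deriv g x) * (q x - 1 / ((n : ℝ) + 1))
            + (m x - g x) * deriv q x) atTop
            (𝓝 ((m' x - deriv g x) * q x + (m x - g x) * deriv q x)) := by
          simpa using ((ht.const_sub (q x)).const_mul (m' x - deriv g x)).add_const
            ((m x - g x) * deriv q x)
        refine h1.congr' ?_
        filter_upwards [ht.eventually (gt_mem_nhds hx0)] with n hn
        rw [hGin _ x hxU hn]
    · rw [Set.indicator_of_notMem hxU]
      refine tendsto_const_nhds.congr fun n => ?_
      rw [hGout _ x fun h => hxU h.1]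
  rw [← integral_indicator hUm]
  refine tendsto_nhds_unique hlimit ?_
  simp only [hzero]
  exact tendsto_const_nhds

end Line

/-! ### From lines to `ℝᵈ` by Fubini's theorem. -/

/-- If the integral of `h` vanishes on every line of direction `v` on which the integrable
functions `F j` are integrable, then the integral of `h` vanishes. -/
theorem integral_eq_zero_of_forall_line {E ι : Type*} [NormedAddCommGroup E] [NormedSpace ℝ E]
    [FiniteDimensional ℝ E] [MeasurableSpace E] [BorelSpace E] {μ : Measure E}
    [μ.IsAddHaarMeasure] [Countable ι] {v : E} (hv : v ≠ 0) {F : ι → E → ℝ}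
    (hF : ∀ j, Integrable (F j) μ) {h : E → ℝ} (hh : Integrable h μ)
    (H : ∀ x, (∀ j, Integrable fun s : ℝ => F j (x + s • v)) → ∫ s : ℝ, h (x + s • v) = 0) :
    ∫ x, h x ∂μ = 0 := by
  have : Nontrivial E := nontrivial_iff.2 ⟨v, 0, hv⟩
  let n := Module.finrank ℝ E
  let E' := Fin (n - 1) → ℝ
  obtain ⟨L, hL⟩ : ∃ L : E ≃L[ℝ] (E' × ℝ), L v = (0, 1) := by
    have : Module.finrank ℝ (E' × ℝ) = n := by
      simpa [E'] using Nat.sub_add_cancel Module.finrank_pos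
    have L₀ : E ≃L[ℝ] (E' × ℝ) := (ContinuousLinearEquiv.ofFinrankEq this).symm
    obtain ⟨M, hM⟩ : ∃ M : (E' × ℝ) ≃L[ℝ] (E' × ℝ), M (L₀ v) = (0, 1) := by
      apply SeparatingDual.exists_continuousLinearEquiv_apply_eq
      · simpa using hv
      · simp
    exact ⟨L₀.trans M, by simp [hM]⟩
  have L_emb : MeasurableEmbedding L.symm := L.symm.toHomeomorph.measurableEmbedding
  let ν := Measure.map L μ
  have hμ : μ = Measure.map L.symm ν := by
    simp [ν, Measure.map_map L.symm.continuous.measurable L.continuous.measurable]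
  let ρ : Measure (E' × ℝ) := Measure.prod volume volume
  -- Proportionality is used in both directions: `A` carries integrability over to the product
  -- measure, `B` rewrites the integral as one over the product.
  have A : ρ = Measure.addHaarScalarFactor ρ ν • ν := Measure.isAddLeftInvariant_eq_smul _ _
  have B : ν = Measure.addHaarScalarFactor ν ρ • ρ := Measure.isAddLeftInvariant_eq_smul _ _
  have hint : ∀ f : E → ℝ, Integrable f μ → Integrable (fun z => f (L.symm z)) ρ := by
    intro f hf
    rw [A]
    refine Integrable.smul_measure_nnreal ?_
    rw [hμ, L_emb.integrable_map_iff] at hf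
    exact hf
  have hline : ∀ (y : E') (s : ℝ), L.symm (y, s) = L.symm (y, 0) + s • v := by
    intro y s
    apply L.injective
    simp [hL]
  rw [hμ, L_emb.integral_map, B, integral_smul_nnreal_measure, integral_prod _ (hint h hh)]
  have h0 : ∀ᵐ y : E', ∫ s : ℝ, h (L.symm (y, s)) = 0 := by
    have : ∀ᵐ y : E', ∀ j, Integrable fun s : ℝ => F j (L.symm (y, s)) :=
      ae_all_iff.2 fun j => (hint _ (hF j)).prod_right_ae
    filter_upwards [this] with y hy
    refine (integral_congr_ae (Eventually.of_forall fun s => congrArg h (hline y s))).trans ?_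
    refine H _ fun j => (hy j).congr (Eventually.of_forall fun s => congrArg (F j) (hline y s))
  rw [integral_congr_ae h0, integral_zero, smul_zero]

theorem _root_.AbsolutelyContinuousOnInterval.comp_affine {f : ℝ → ℝ} {a b c e α β : ℝ}
    (hα : 0 < α) (hf : AbsolutelyContinuousOnInterval f c e)
    (hmaps : Set.MapsTo (fun x => α * x + β) (Set.uIcc a b) (Set.uIcc c e)) :
    AbsolutelyContinuousOnInterval (fun x => f (α * x + β)) a b := by
  rw [absolutelyContinuousOnInterval_iff] at hf ⊢
  intro ε hε
  obtain ⟨δ, hδ, H⟩ := hf ε hε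
  refine ⟨δ / α, div_pos hδ hα, fun E hE hlt => ?_⟩
  refine H (E.1, fun i => (α * (E.2 i).1 + β, α * (E.2 i).2 + β)) ⟨fun i hi => ?_, ?_⟩ ?_
  · exact ⟨hmaps (hE.1 i hi).1, hmaps (hE.1 i hi).2⟩
  · intro i hi j hj hij
    have hd := hE.2 hi hj hij
    simp only [Function.onFun] at hd ⊢
    rw [Set.disjoint_left] at hd ⊢
    have key : ∀ x y z : ℝ, z ∈ Set.uIoc (α * x + β) (α * y + β) → (z - β) / α ∈ Set.uIoc x y := by
      intro x y z hz
      rw [Set.mem_uIoc] at hz ⊢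
      rcases hz with ⟨h1, h2⟩ | ⟨h1, h2⟩
      · left
        constructor
        · rw [lt_div_iff₀ hα]; linarith
        · rw [div_le_iff₀ hα]; linarith
      · right
        constructor
        · rw [lt_div_iff₀ hα]; linarith
        · rw [div_le_iff₀ hα]; linarith
    exact fun z hz hz' => hd (key _ _ z hz) (key _ _ z hz')
  · have : ∀ x y : ℝ, dist (α * x + β) (α * y + β) = α * dist x y := by
      intro x y
      rw [Real.dist_eq, Real.dist_eq, ← abs_of_pos hα, ← abs_mul, abs_of_pos hα]
      congr 1; ring
    simp only [this, ← Finset.mul_sum]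
    rw [lt_div_iff₀ hα] at hlt
    linarith

/-- `IsAbsCont` parametrises segments by `[0, 1]`; an affine change of variable gives the
parametrisation by `[a, b]`. The case `a = b`, which has no rescaling, is treated directly. -/
theorem IsAbsCont.absolutelyContinuousOnInterval_line {d : ℕ} {Θ₀ : Set (Vec d)} {f : Vec d → ℝ}
    (hf : IsAbsCont Θ₀ f) (x v : Vec d) {a b : ℝ}
    (hab : Set.uIcc a b ⊆ {s : ℝ | x + s • v ∈ Θ₀}) :
    AbsolutelyContinuousOnInterval (fun s : ℝ => f (x + s • v)) a b := by
  wlog h : a ≤ b generalizing a b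
  · exact (this (by rwa [Set.uIcc_comm]) (le_of_not_ge h)).symm
  rw [Set.uIcc_of_le h] at hab
  rcases h.eq_or_lt with rfl | h
  · rw [absolutelyContinuousOnInterval_iff]
    refine fun ε hε => ⟨1, one_pos, fun E hE _ => ?_⟩
    have : ∀ i ∈ Finset.range E.1, dist (f (x + (E.2 i).1 • v)) (f (x + (E.2 i).2 • v)) = 0 := by
      intro i hi
      have h1 := hE.1 i hi
      rw [Set.uIcc_self, Set.mem_singleton_iff, Set.mem_singleton_iff] at h1
      rw [h1.1, h1.2, dist_self]
    rw [Finset.sum_eq_zero this]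
    exact hε
  have hba : 0 < b - a := sub_pos.2 h
  have hlm : ∀ s : ℝ, AffineMap.lineMap (x + a • v) (x + b • v) s = x + (a + s * (b - a)) • v := by
    intro s
    rw [AffineMap.lineMap_apply_module]
    module
  have hseg : segment ℝ (x + a • v) (x + b • v) ⊆ Θ₀ := by
    rw [segment_eq_image_lineMap]
    rintro _ ⟨s, hs, rfl⟩
    rw [hlm]
    refine hab ⟨?_, ?_⟩
    · nlinarith [hs.1]
    · nlinarith [hs.2]
  have := (hf _ _ hseg).comp_affine (a := a) (b := b) (β := -(a / (b - a))) (inv_pos.2 hba) (by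
    rw [Set.uIcc_of_le h.le, Set.uIcc_of_le zero_le_one]
    intro s hs
    have : (b - a)⁻¹ * s + -(a / (b - a)) = (s - a) / (b - a) := by field_simp; ring
    simp only [this]
    exact ⟨div_nonneg (by linarith [hs.1]) hba.le, (div_le_one hba).2 (by linarith [hs.2])⟩)
  convert! this using 3 with s
  rw [hlm]
  congr 2
  field_simp
  ring

theorem deriv_line_eq_partialDeriv {d : ℕ} (f : Vec d → ℝ) (i : Fin d) (x : Vec d) (s : ℝ) :
    deriv (fun r : ℝ => f (x + r • basisVec i)) s = partialDeriv f i (x + s • basisVec i) := by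
  rw [partialDeriv, lineDeriv]
  have := deriv_comp_const_add (f := fun r : ℝ => f (x + r • basisVec i)) s 0
  rw [add_zero] at this
  rw [← this]
  congr 1
  ext r
  rw [add_smul, add_assoc]

theorem basisVec_ne_zero {d : ℕ} (i : Fin d) : (basisVec i : Vec d) ≠ 0 := by
  intro h
  have := congrArg (fun v : Vec d => v i) h
  simp [basisVec] at this

/-- Integration by parts on an open set `Θ₀` for a density `q` which vanishes at the boundary along
lines parallel to the coordinate axes. -/
theorem integral_partialDeriv_eq_zero {d : ℕ} {Θ₀ : Set (Vec d)} (hΘ₀ : IsOpen Θ₀) (i : Fin d)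
    {m m' g q : Vec d → ℝ} (hq0 : ∀ t ∈ Θ₀, 0 ≤ q t) (hq : IsAbsCont Θ₀ q) (hg : IsAbsCont Θ₀ g)
    (hm : ∀ t ∈ Θ₀, HasDerivAt (fun s : ℝ => m (t + s • basisVec i)) (m' t) 0)
    (hlim : ∀ b ∈ frontier Θ₀,
      Tendsto (fun s : ℝ => q (b + s • basisVec i)) (𝓝[{s : ℝ | b + s • basisVec i ∈ Θ₀}] 0) (𝓝 0))
    (hm'q : IntegrableOn (fun t => m' t * q t) Θ₀)
    (hg'q : IntegrableOn (fun t => partialDeriv g i t * q t) Θ₀)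
    (hmgq : IntegrableOn (fun t => (m t - g t) * q t) Θ₀)
    (hmgq' : IntegrableOn (fun t => (m t - g t) * partialDeriv q i t) Θ₀) :
    ∫ t in Θ₀, ((m' t - partialDeriv g i t) * q t + (m t - g t) * partialDeriv q i t) = 0 := by
  have hΘm := hΘ₀.measurableSet
  have hsum : IntegrableOn (fun t => (m' t - partialDeriv g i t) * q t
      + (m t - g t) * partialDeriv q i t) Θ₀ := by
    have := (hm'q.sub hg'q).add hmgq'
    refine this.congr (Eventually.of_forall fun t => ?_)
    simp only [Pi.add_apply, Pi.sub_apply]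
    ring
  rw [← integral_indicator hΘm]
  -- These are the four functions whose integrability is required on a line; by Fubini it holds on
  -- almost every line.
  set F : Fin 4 → Vec d → ℝ := ![fun t => m' t * q t, fun t => partialDeriv g i t * q t,
    fun t => (m t - g t) * q t, fun t => (m t - g t) * partialDeriv q i t] with hF
  refine integral_eq_zero_of_forall_line (basisVec_ne_zero i) (F := fun j => Θ₀.indicator (F j))
    (fun j => ?_) (hsum.integrable_indicator hΘm) fun x hx => ?_
  · rw [integrable_indicator_iff hΘm]
    fin_cases j
    exacts [hm'q, hg'q, hmgq, hmgq']
  · set U : Set ℝ := {s : ℝ | x + s • basisVec i ∈ Θ₀} with hUdef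
    have hcont : Continuous fun s : ℝ => x + s • (basisVec i : Vec d) := by fun_prop
    have hU : IsOpen U := hΘ₀.preimage hcont
    have hind : ∀ (f : Vec d → ℝ), (fun s : ℝ => Θ₀.indicator f (x + s • basisVec i)) =
        U.indicator fun s => f (x + s • basisVec i) := fun f => by
      rfl
    have hx' : ∀ j, IntegrableOn (fun s : ℝ => F j (x + s • basisVec i)) U := by
      intro j
      have := hx j
      rwa [hind, integrable_indicator_iff hU.measurableSet] at this
    rw [hind, integral_indicator hU.measurableSet]
    have hshift : ∀ s r : ℝ, x + s • (basisVec i : Vec d) + (r - s) • basisVec i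
        = x + r • basisVec i := fun s r => by module
    have key := integral_line_eq_zero (U := U) (m := fun s => m (x + s • basisVec i))
      (m' := fun s => m' (x + s • basisVec i)) (g := fun s => g (x + s • basisVec i))
      (q := fun s => q (x + s • basisVec i)) hU (fun s hs => hq0 _ hs)
      (fun a b hab => hq.absolutelyContinuousOnInterval_line x _ hab)
      (fun a b hab => hg.absolutelyContinuousOnInterval_line x _ hab)
      (fun s hs => by
        have h1 := hm _ hs
        rw [← sub_self s] at h1
        have h2 := HasDerivAt.comp_sub_const s s h1
        simpa only [hshift] using h2)
      (fun b hb => by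
        -- A boundary point of the slice is a limit of points of `Θ₀` and, the slice being open, is
        -- not itself in `Θ₀`.
        have hbΘ : x + b • basisVec i ∈ frontier Θ₀ := by
          refine ⟨?_, ?_⟩
          · exact map_mem_closure (f := fun s : ℝ => x + s • (basisVec i : Vec d)) hcont hb.1 fun s hs => hs
          · have := hb.2
            rw [hU.interior_eq] at this
            rw [hΘ₀.interior_eq]
            exact this
        have h1 : Tendsto (fun r : ℝ => r - b) (𝓝[U] b)
            (𝓝[{s : ℝ | x + b • basisVec i + s • basisVec i ∈ Θ₀}] 0) := by
          refine tendsto_nhdsWithin_iff.2 ⟨?_, ?_⟩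
          · have : Tendsto (fun r : ℝ => r - b) (𝓝 b) (𝓝 (b - b)) :=
              (continuous_id.sub continuous_const).tendsto b
            rw [sub_self] at this
            exact this.mono_left nhdsWithin_le_nhds
          · filter_upwards [self_mem_nhdsWithin] with r hr
            rw [hshift]
            exact hr
        have h2 := (hlim _ hbΘ).comp h1
        simpa only [Function.comp_def, hshift] using h2)
      (by simpa [hF] using hx' 0)
      (by simpa [hF, deriv_line_eq_partialDeriv] using hx' 1)
      (by simpa [hF] using hx' 2)
      (by simpa [hF, deriv_line_eq_partialDeriv] using hx' 3)
    simpa only [deriv_line_eq_partialDeriv] using key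

/-! ### Weak limits in `L²` and differentiation of `∫ S a_s²`. -/

section SquareIntegrable

variable {𝓧 : Type*} [MeasurableSpace 𝓧] {ν : Measure 𝓧}

theorem norm_toLp_sq {f : 𝓧 → ℝ} (hf : MemLp f 2 ν) : ‖hf.toLp f‖ ^ 2 = ∫ x, f x ^ 2 ∂ν := by
  rw [← real_inner_self_eq_norm_sq, L2.inner_def]
  refine integral_congr_ae ?_
  filter_upwards [hf.coeFn_toLp] with x hx
  rw [hx]
  simp [sq]

theorem inner_toLp_toLp {f g : 𝓧 → ℝ} (hf : MemLp f 2 ν) (hg : MemLp g 2 ν) :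
    inner ℝ (hf.toLp f) (hg.toLp g) = ∫ x, f x * g x ∂ν := by
  rw [L2.inner_def]
  refine integral_congr_ae ?_
  filter_upwards [hf.coeFn_toLp, hg.coeFn_toLp] with x hx hx'
  rw [hx, hx']
  simp [mul_comm]

/-- The Cauchy–Schwarz inequality for integrals. -/
theorem abs_integral_mul_le {f g : 𝓧 → ℝ} (hf : MemLp f 2 ν) (hg : MemLp g 2 ν) :
    |∫ x, f x * g x ∂ν| ≤ √(∫ x, f x ^ 2 ∂ν) * √(∫ x, g x ^ 2 ∂ν) := by
  rw [← inner_toLp_toLp hf hg, ← norm_toLp_sq hf, ← norm_toLp_sq hg,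
    Real.sqrt_sq (norm_nonneg _), Real.sqrt_sq (norm_nonneg _)]
  exact abs_real_inner_le_norm _ _

theorem integral_add_sq_le {f g : 𝓧 → ℝ} (hf : MemLp f 2 ν) (hg : MemLp g 2 ν) :
    ∫ x, (f x + g x) ^ 2 ∂ν ≤ 2 * ∫ x, f x ^ 2 ∂ν + 2 * ∫ x, g x ^ 2 ∂ν := by
  rw [← integral_const_mul, ← integral_const_mul, ← integral_add (hf.integrable_sq.const_mul 2)
    (hg.integrable_sq.const_mul 2)]
  refine integral_mono (hf.add hg).integrable_sq
    ((hf.integrable_sq.const_mul 2).add (hg.integrable_sq.const_mul 2)) fun x => ?_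
  simp only
  nlinarith [sq_nonneg (f x - g x)]

theorem tendsto_integral_tail_sq {S ρ : 𝓧 → ℝ} (hS : Measurable S) (hρ : MemLp ρ 2 ν) :
    Tendsto (fun n : ℕ => ∫ x, ({x | (n : ℝ) < |S x|}.indicator ρ x) ^ 2 ∂ν) atTop (𝓝 0) := by
  have hms : ∀ n : ℕ, MeasurableSet {x | (n : ℝ) < |S x|} := fun n =>
    measurableSet_lt measurable_const (by fun_prop)
  have : Tendsto (fun n : ℕ => ∫ x, ({x | (n : ℝ) < |S x|}.indicator ρ x) ^ 2 ∂ν) atTop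
      (𝓝 (∫ _, (0 : ℝ) ∂ν)) := by
    refine tendsto_integral_of_dominated_convergence (fun x => ρ x ^ 2)
      (fun n => (hρ.1.indicator (hms n)).pow 2) hρ.integrable_sq
      (fun n => Eventually.of_forall fun x => ?_) (Eventually.of_forall fun x => ?_)
    · rw [Real.norm_eq_abs, abs_of_nonneg (sq_nonneg _)]
      by_cases hx : x ∈ {x | (n : ℝ) < |S x|}
      · rw [Set.indicator_of_mem hx]
      · rw [Set.indicator_of_notMem hx, sq, zero_mul]
        exact sq_nonneg _
    · refine tendsto_const_nhds.congr' ?_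
      filter_upwards [tendsto_natCast_atTop_atTop.eventually_ge_atTop (|S x|)] with n hn
      rw [Set.indicator_of_notMem (show x ∉ {x | (n : ℝ) < |S x|} from not_lt.2 hn)]
      simp
  simpa using this

/-- If `e → 0` in `L²` and `S e` is bounded in `L²` then `S e` tends weakly to zero. -/
theorem tendsto_integral_mul_of_bounded {ι : Type*} {l : Filter ι} {S ρ : 𝓧 → ℝ} {e : ι → 𝓧 → ℝ}
    {C : ℝ} (hS : Measurable S) (hρ : MemLp ρ 2 ν) (he : ∀ᶠ s in l, MemLp (e s) 2 ν)
    (hSe : ∀ᶠ s in l, MemLp (fun x => S x * e s x) 2 ν)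
    (hC : ∀ᶠ s in l, ∫ x, (S x * e s x) ^ 2 ∂ν ≤ C)
    (hlim : Tendsto (fun s => ∫ x, e s x ^ 2 ∂ν) l (𝓝 0)) :
    Tendsto (fun s => ∫ x, S x * e s x * ρ x ∂ν) l (𝓝 0) := by
  rw [Metric.tendsto_nhds]
  intro ε hε
  have h1 := ((tendsto_integral_tail_sq hS hρ).sqrt.const_mul (√C))
  rw [Real.sqrt_zero, mul_zero] at h1
  -- The level `n` makes the tail of `ρ` on `{|S| > n}` small against the bound `√C` on `S e`. Off
  -- this set `|S e| ≤ n |e|`, which tends to 0 in `L²`.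
  obtain ⟨n, hn⟩ := (h1.eventually (gt_mem_nhds (half_pos hε))).exists
  set B : Set 𝓧 := {x | (n : ℝ) < |S x|} with hB
  have hms : MeasurableSet B := measurableSet_lt measurable_const (by fun_prop)
  have h2 := (hlim.sqrt.const_mul (n : ℝ)).mul_const (√(∫ x, ρ x ^ 2 ∂ν))
  rw [Real.sqrt_zero, mul_zero, zero_mul] at h2
  filter_upwards [he, hSe, hC, h2.eventually (gt_mem_nhds (half_pos hε))] with s hes hSes hCs h3
  have hρB : MemLp (B.indicator ρ) 2 ν := hρ.indicator hms
  have hSB : MemLp (fun x => Bᶜ.indicator S x * e s x) 2 ν := by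
    refine (hes.const_mul (n : ℝ)).of_le ?_ (Eventually.of_forall fun x => ?_)
    · exact (hS.indicator hms.compl).aestronglyMeasurable.mul hes.1
    · rw [norm_mul, norm_mul]
      gcongr
      by_cases hx : x ∈ B
      · rw [Set.indicator_of_notMem (by simpa using hx)]
        simp
      · rw [Set.indicator_of_mem (by simpa using hx), Real.norm_eq_abs, Real.norm_natCast]
        exact not_lt.1 hx
  have hsplit : ∫ x, S x * e s x * ρ x ∂ν = ∫ x, Bᶜ.indicator S x * e s x * ρ x ∂ν +
      ∫ x, S x * e s x * B.indicator ρ x ∂ν := by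
    refine Eq.trans ?_ (integral_add (hSB.integrable_mul hρ) (hSes.integrable_mul hρB))
    congr 1
    ext x
    by_cases hx : x ∈ B <;> simp [hx]
  have hb1 := abs_integral_mul_le hSB hρ
  have hb2 := abs_integral_mul_le hSes hρB
  have hb3 : √(∫ x, (Bᶜ.indicator S x * e s x) ^ 2 ∂ν) ≤ n * √(∫ x, e s x ^ 2 ∂ν) := by
    rw [Real.sqrt_le_left (by positivity), mul_pow, Real.sq_sqrt (integral_nonneg fun x => sq_nonneg _),
      ← integral_const_mul]
    refine integral_mono hSB.integrable_sq (hes.integrable_sq.const_mul _) fun x => ?_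
    simp only [mul_pow]
    gcongr ?_ * _
    rw [sq_le_sq, Nat.abs_cast]
    by_cases hx : x ∈ B
    · rw [Set.indicator_of_notMem (by simpa using hx)]
      simp
    · rw [Set.indicator_of_mem (by simpa using hx)]
      exact not_lt.1 hx
  rw [dist_zero_right, Real.norm_eq_abs, hsplit]
  have hb4 : √(∫ x, (S x * e s x) ^ 2 ∂ν) ≤ √C := Real.sqrt_le_sqrt hCs
  calc _ ≤ |∫ x, Bᶜ.indicator S x * e s x * ρ x ∂ν| + |∫ x, S x * e s x * B.indicator ρ x ∂ν| :=
        abs_add_le _ _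
    _ ≤ n * √(∫ x, e s x ^ 2 ∂ν) * √(∫ x, ρ x ^ 2 ∂ν) +
          √C * √(∫ x, (B.indicator ρ x) ^ 2 ∂ν) := by
        refine add_le_add (hb1.trans ?_) (hb2.trans ?_)
        · gcongr
        · gcongr
    _ < ε / 2 + ε / 2 := add_lt_add h3 hn
    _ = ε := by ring

/-- The derivative of `s ↦ ∫ S a_s²`, for a path `a` which is differentiable in `L²` and such that
`S a_s` is bounded in `L²`. -/
theorem hasDerivAt_integral_mul_sq {S ρ : 𝓧 → ℝ} {a : ℝ → 𝓧 → ℝ} {C : ℝ} (hS : Measurable S)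
    (hρ : MemLp ρ 2 ν) (ha : ∀ᶠ s in 𝓝 0, MemLp (a s) 2 ν)
    (hSa : ∀ᶠ s in 𝓝 0, MemLp (fun x => S x * a s x) 2 ν)
    (hC : ∀ᶠ s in 𝓝 0, ∫ x, (S x * a s x) ^ 2 ∂ν ≤ C)
    (hlim : Tendsto (fun s => ∫ x, (a s x - a 0 x) ^ 2 ∂ν) (𝓝 0) (𝓝 0))
    (hr : (fun s => ∫ x, (a s x - a 0 x - s * ρ x) ^ 2 ∂ν) =o[𝓝 0] fun s => s ^ 2) :
    HasDerivAt (fun s => ∫ x, S x * a s x ^ 2 ∂ν) (2 * ∫ x, S x * a 0 x * ρ x ∂ν) 0 := by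
  have ha0 := ha.self_of_nhds
  have hSa0 := hSa.self_of_nhds
  have hC0 := hC.self_of_nhds
  have hC' : 0 ≤ C := (integral_nonneg fun x => sq_nonneg _).trans hC0
  -- The squared norms of `S (a_s ± a_0)` are at most `2C + 2C`; this is the `4 * C` here and the
  -- factor `2 * √C` below.
  have hweak := tendsto_integral_mul_of_bounded (e := fun s x => a s x - a 0 x) (l := 𝓝 (0 : ℝ))
    (C := 4 * C) hS hρ
    (ha.mono fun s hs => hs.sub ha0)
    (hSa.mono fun s hs => by
      simp only [mul_sub]; exact hs.sub hSa0)
    (by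
      filter_upwards [hSa, hC] with s hs hs'
      have := integral_add_sq_le hs hSa0.neg
      simp only [Pi.neg_apply, ← sub_eq_add_neg, ← mul_sub, neg_sq] at this
      linarith) hlim
  have hrs : (fun s => √(∫ x, (a s x - a 0 x - s * ρ x) ^ 2 ∂ν)) =o[𝓝 0] fun s : ℝ => s := by
    refine IsLittleO.of_pow (n := 2) ?_ two_ne_zero
    refine hr.congr (fun s => ?_) fun s => rfl
    exact (Real.sq_sqrt (integral_nonneg fun x => sq_nonneg _)).symm
  rw [hasDerivAt_iff_isLittleO_nhds_zero]
  have h1 : (fun s => 2 * √C * √(∫ x, (a s x - a 0 x - s * ρ x) ^ 2 ∂ν)) =o[𝓝 0] fun s : ℝ => s :=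
    hrs.const_mul_left _
  have h2 : (fun s => s * ∫ x, S x * (a s x - a 0 x) * ρ x ∂ν) =o[𝓝 0] fun s : ℝ => s := by
    have := (isBigO_refl (fun s : ℝ => s) (𝓝 0)).mul_isLittleO ((isLittleO_one_iff ℝ).2 hweak)
    simpa using this
  refine (IsBigO.of_bound 1 ?_).trans_isLittleO (h1.norm_left.add h2.norm_left)
  filter_upwards [ha, hSa, hC] with s hs hSs hCs
  have hSp : MemLp (fun x => S x * (a s x + a 0 x)) 2 ν := by
    simp only [mul_add]; exact hSs.add hSa0
  have hSm : MemLp (fun x => S x * (a s x - a 0 x)) 2 ν := by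
    simp only [mul_sub]; exact hSs.sub hSa0
  have hrem : MemLp (fun x => a s x - a 0 x - s * ρ x) 2 ν := (hs.sub ha0).sub (hρ.const_mul s)
  have i1 : Integrable (fun x => S x * a s x ^ 2) ν := by
    refine (hSs.integrable_mul hs).congr (Eventually.of_forall fun x => ?_)
    simp only [Pi.mul_apply]; ring
  have i2 : Integrable (fun x => S x * a 0 x ^ 2) ν := by
    refine (hSa0.integrable_mul ha0).congr (Eventually.of_forall fun x => ?_)
    simp only [Pi.mul_apply]; ring
  have i3 : Integrable (fun x => S x * a 0 x * ρ x) ν := hSa0.integrable_mul hρ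
  have i4 : Integrable (fun x => S x * (a s x + a 0 x) * (a s x - a 0 x - s * ρ x)) ν :=
    hSp.integrable_mul hrem
  have i5 : Integrable (fun x => S x * (a s x - a 0 x) * ρ x) ν := hSm.integrable_mul hρ
  -- The remainder splits in two: Cauchy–Schwarz and the `L²` differentiability of `a` handle the
  -- first term, the weak convergence `hweak` the second.
  have key : (∫ x, S x * a (0 + s) x ^ 2 ∂ν) - (∫ x, S x * a 0 x ^ 2 ∂ν) -
      s • (2 * ∫ x, S x * a 0 x * ρ x ∂ν) =
      (∫ x, S x * (a s x + a 0 x) * (a s x - a 0 x - s * ρ x) ∂ν) +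
        s * ∫ x, S x * (a s x - a 0 x) * ρ x ∂ν := by
    rw [zero_add, smul_eq_mul, ← mul_assoc, ← integral_const_mul, ← integral_const_mul,
      ← integral_sub i1 i2]
    refine (integral_sub (i1.sub i2) (i3.const_mul _)).symm.trans
      (Eq.trans ?_ (integral_add i4 (i5.const_mul _)))
    congr 1
    ext x
    simp only [Pi.sub_apply]
    ring
  rw [key, one_mul]
  refine (norm_add_le _ _).trans ?_
  rw [Real.norm_eq_abs (_ + _), abs_of_nonneg (add_nonneg (norm_nonneg _) (norm_nonneg _))]
  refine add_le_add_left ?_ _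
  rw [Real.norm_eq_abs, Real.norm_eq_abs]
  refine ((abs_integral_mul_le hSp hrem).trans ?_).trans (le_abs_self _)
  gcongr
  rw [Real.sqrt_le_left (by positivity), mul_pow, Real.sq_sqrt hC']
  have := integral_add_sq_le hSs hSa0
  simp only [← mul_add] at this
  linarith

end SquareIntegrable

/-! ### Hellinger differentiable models as differentiable maps into `L²(ν)`. -/

variable {d : ℕ} {𝓧 : Type*} [MeasurableSpace 𝓧]

/-- A dominated statistical model which is Hellinger differentiable on an open set. -/
structure IsHellingerModel (ν : Measure 𝓧) (Θ₀ : Set (Vec d)) (P : Vec d → Measure 𝓧)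
    (ξ : Vec d → 𝓧 → Vec d) : Prop where
  isOpen : IsOpen Θ₀
  isProbabilityMeasure : ∀ θ ∈ Θ₀, IsProbabilityMeasure (P θ)
  absolutelyContinuous : ∀ θ ∈ Θ₀, P θ ≪ ν
  hasHellingerDerivAt : ∀ θ ∈ Θ₀, HasHellingerDerivAt P ν θ (ξ θ)

open scoped Classical in
/-- The square root of the density as an element of `L²(ν)`. -/
noncomputable def sqrtDensityLp (P : Vec d → Measure 𝓧) (ν : Measure 𝓧) (θ : Vec d) : Lp ℝ 2 ν :=
  if h : MemLp (sqrtDensity P ν θ) 2 ν then h.toLp _ else 0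

theorem measurable_sqrtDensity (P : Vec d → Measure 𝓧) (ν : Measure 𝓧) (θ : Vec d) :
    Measurable (sqrtDensity P ν θ) :=
  ((Measure.measurable_rnDeriv _ _).ennreal_toReal).sqrt

theorem sqrtDensity_sq (P : Vec d → Measure 𝓧) (ν : Measure 𝓧) (θ : Vec d) (x : 𝓧) :
    sqrtDensity P ν θ x ^ 2 = ((P θ).rnDeriv ν x).toReal :=
  Real.sq_sqrt ENNReal.toReal_nonneg

namespace IsHellingerModel

variable {ν : Measure 𝓧} {Θ₀ : Set (Vec d)} {P : Vec d → Measure 𝓧}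
  {ξ : Vec d → 𝓧 → Vec d} {θ t : Vec d}

theorem eventually_mem (M : IsHellingerModel ν Θ₀ P ξ) (ht : t ∈ Θ₀) :
    ∀ᶠ h in 𝓝 (0 : Vec d), t + h ∈ Θ₀ := by
  have : Tendsto (fun h : Vec d => t + h) (𝓝 0) (𝓝 (t + 0)) :=
    (continuous_const.add continuous_id).tendsto 0
  rw [add_zero] at this
  exact this.eventually (M.isOpen.mem_nhds ht)

theorem eventually_mem_line (M : IsHellingerModel ν Θ₀ P ξ) (ht : t ∈ Θ₀) (v : Vec d) :
    ∀ᶠ s : ℝ in 𝓝 0, t + s • v ∈ Θ₀ := by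
  have : Tendsto (fun s : ℝ => s • v) (𝓝 0) (𝓝 ((0 : ℝ) • v)) :=
    (continuous_id.smul continuous_const).tendsto 0
  rw [zero_smul] at this
  exact this.eventually (M.eventually_mem ht)

theorem memLp_score (M : IsHellingerModel ν Θ₀ P ξ) (ht : t ∈ Θ₀) (i : Fin d) :
    MemLp (fun x => ξ t x i) 2 ν :=
  (M.hasHellingerDerivAt t ht).1.eval_piLp i

theorem memLp_inner_score (M : IsHellingerModel ν Θ₀ P ξ) (ht : t ∈ Θ₀) (v : Vec d) :
    MemLp (fun x => inner ℝ v (ξ t x)) 2 ν :=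
  (M.hasHellingerDerivAt t ht).1.const_inner v

theorem isLittleO_line (M : IsHellingerModel ν Θ₀ P ξ) (ht : t ∈ Θ₀) (v : Vec d) :
    (fun s : ℝ => ∫ x, (sqrtDensity P ν (t + s • v) x - sqrtDensity P ν t x -
      s * inner ℝ v (ξ t x)) ^ 2 ∂ν) =o[𝓝 0] fun s : ℝ => s ^ 2 := by
  have h0 : Tendsto (fun s : ℝ => s • v) (𝓝 0) (𝓝 0) := by
    have : Tendsto (fun s : ℝ => s • v) (𝓝 0) (𝓝 ((0 : ℝ) • v)) :=
      (continuous_id.smul continuous_const).tendsto 0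
    rwa [zero_smul] at this
  have h1 := (M.hasHellingerDerivAt t ht).2.comp_tendsto h0
  simp only [Function.comp_def, real_inner_smul_left, norm_smul, mul_pow] at h1
  refine h1.trans_isBigO (IsBigO.of_bound (‖v‖ ^ 2) (Eventually.of_forall fun s => ?_))
  simp [mul_comm]

variable [SigmaFinite ν]

theorem integrable_iff (M : IsHellingerModel ν Θ₀ P ξ) (hθ : θ ∈ Θ₀) {f : 𝓧 → ℝ} :
    Integrable f (P θ) ↔ Integrable (fun x => f x * sqrtDensity P ν θ x ^ 2) ν := by
  have := M.isProbabilityMeasure θ hθ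
  rw [← integrable_rnDeriv_smul_iff (M.absolutelyContinuous θ hθ)]
  simp only [sqrtDensity_sq, smul_eq_mul, mul_comm]

theorem integral_eq (M : IsHellingerModel ν Θ₀ P ξ) (hθ : θ ∈ Θ₀) (f : 𝓧 → ℝ) :
    ∫ x, f x ∂(P θ) = ∫ x, f x * sqrtDensity P ν θ x ^ 2 ∂ν := by
  have := M.isProbabilityMeasure θ hθ
  rw [← integral_rnDeriv_smul (M.absolutelyContinuous θ hθ)]
  simp only [sqrtDensity_sq, smul_eq_mul, mul_comm]

theorem memLp_mul_sqrtDensity (M : IsHellingerModel ν Θ₀ P ξ) (hθ : θ ∈ Θ₀) {S : 𝓧 → ℝ}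
    (hS : Measurable S) (h2 : Integrable (fun x => S x ^ 2) (P θ)) :
    MemLp (fun x => S x * sqrtDensity P ν θ x) 2 ν := by
  refine (memLp_two_iff_integrable_sq
    (hS.mul (measurable_sqrtDensity P ν θ)).aestronglyMeasurable).2 ?_
  exact ((M.integrable_iff hθ).1 h2).congr (Eventually.of_forall fun x => (mul_pow _ _ _).symm)

theorem memLp_sqrtDensity (M : IsHellingerModel ν Θ₀ P ξ) (hθ : θ ∈ Θ₀) :
    MemLp (sqrtDensity P ν θ) 2 ν := by
  have := M.isProbabilityMeasure θ hθ
  simpa using M.memLp_mul_sqrtDensity hθ (measurable_const (a := (1 : ℝ))) (by simp)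

theorem sqrtDensityLp_eq (M : IsHellingerModel ν Θ₀ P ξ) (hθ : θ ∈ Θ₀) :
    sqrtDensityLp P ν θ = (M.memLp_sqrtDensity hθ).toLp _ :=
  dif_pos _

theorem norm_sqrtDensityLp_sub_sq (M : IsHellingerModel ν Θ₀ P ξ) (hθ : θ ∈ Θ₀) (ht : t ∈ Θ₀) :
    ‖sqrtDensityLp P ν θ - sqrtDensityLp P ν t‖ ^ 2 =
      ∫ x, (sqrtDensity P ν θ x - sqrtDensity P ν t x) ^ 2 ∂ν := by
  rw [M.sqrtDensityLp_eq hθ, M.sqrtDensityLp_eq ht, ← MemLp.toLp_sub, norm_toLp_sq]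
  rfl

/-- A Hellinger differentiable model is a differentiable path in `L²(ν)`. -/
theorem hasFDerivAt_sqrtDensityLp (M : IsHellingerModel ν Θ₀ P ξ) (ht : t ∈ Θ₀) :
    ∃ D : Vec d →L[ℝ] Lp ℝ 2 ν, HasFDerivAt (sqrtDensityLp P ν) D t ∧
      ∀ v, D v = (M.memLp_inner_score ht v).toLp _ := by
  let D₀ : Vec d →ₗ[ℝ] Lp ℝ 2 ν :=
    { toFun := fun v => (M.memLp_inner_score ht v).toLp _
      map_add' := fun v w => by
        rw [← MemLp.toLp_add]
        congr 1
        ext x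
        simp [inner_add_left]
      map_smul' := fun c v => by
        rw [RingHom.id_apply, ← MemLp.toLp_const_smul]
        congr 1
        ext x
        simp [inner_smul_left] }
  refine ⟨LinearMap.toContinuousLinearMap D₀, ?_, fun v => rfl⟩
  rw [hasFDerivAt_iff_isLittleO_nhds_zero]
  refine IsLittleO.of_norm_norm (IsLittleO.of_pow (n := 2) ?_ two_ne_zero)
  refine (M.hasHellingerDerivAt t ht).2.congr' ?_ (Eventually.of_forall fun h => rfl)
  filter_upwards [M.eventually_mem ht] with h hh
  have : (LinearMap.toContinuousLinearMap D₀) h = (M.memLp_inner_score ht h).toLp _ := rfl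
  simp only [Pi.pow_apply]
  rw [this, M.sqrtDensityLp_eq hh, M.sqrtDensityLp_eq ht, ← MemLp.toLp_sub, ← MemLp.toLp_sub,
    norm_toLp_sq]
  rfl

theorem continuousAt_sqrtDensityLp (M : IsHellingerModel ν Θ₀ P ξ) (ht : t ∈ Θ₀) :
    ContinuousAt (sqrtDensityLp P ν) t := by
  obtain ⟨D, hD, -⟩ := M.hasFDerivAt_sqrtDensityLp ht
  exact hD.continuousAt

theorem hasDerivAt_sqrtDensityLp_line (M : IsHellingerModel ν Θ₀ P ξ) (ht : t ∈ Θ₀) (v : Vec d) :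
    HasDerivAt (fun s : ℝ => sqrtDensityLp P ν (t + s • v)) ((M.memLp_inner_score ht v).toLp _)
      0 := by
  obtain ⟨D, hD, hDv⟩ := M.hasFDerivAt_sqrtDensityLp ht
  have := hD.hasLineDerivAt v
  rwa [hDv] at this

theorem tendsto_integral_sqrtDensity_sub_sq (M : IsHellingerModel ν Θ₀ P ξ) (ht : t ∈ Θ₀)
    (v : Vec d) :
    Tendsto (fun s : ℝ => ∫ x, (sqrtDensity P ν (t + s • v) x - sqrtDensity P ν t x) ^ 2 ∂ν)
      (𝓝 0) (𝓝 0) := by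
  have h1 := (M.hasDerivAt_sqrtDensityLp_line ht v).continuousAt.tendsto
  rw [zero_smul, add_zero] at h1
  have h2 := ((tendsto_iff_norm_sub_tendsto_zero.1 h1).pow 2)
  rw [zero_pow two_ne_zero] at h2
  refine h2.congr' ?_
  filter_upwards [M.eventually_mem_line ht v] with s hs
  rw [M.norm_sqrtDensityLp_sub_sq hs ht]

/-- Expectations of bounded statistics are continuous in the parameter. -/
theorem continuousAt_integral_of_bounded (M : IsHellingerModel ν Θ₀ P ξ) (ht : t ∈ Θ₀)
    {f : 𝓧 → ℝ} (hf : Measurable f) {K : ℝ} (hK : ∀ x, |f x| ≤ K) :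
    ContinuousAt (fun θ => ∫ x, f x ∂(P θ)) t := by
  have hL := M.continuousAt_sqrtDensityLp ht
  have h1 : Tendsto (fun θ => ‖sqrtDensityLp P ν θ - sqrtDensityLp P ν t‖) (𝓝 t) (𝓝 0) :=
    tendsto_iff_norm_sub_tendsto_zero.1 hL
  have h2 : Tendsto (fun θ => ‖sqrtDensityLp P ν θ + sqrtDensityLp P ν t‖) (𝓝 t)
      (𝓝 ‖sqrtDensityLp P ν t + sqrtDensityLp P ν t‖) := (hL.tendsto.add_const _).norm
  have h3 := (h1.mul h2).const_mul K
  rw [zero_mul, mul_zero] at h3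
  rw [ContinuousAt, tendsto_iff_norm_sub_tendsto_zero]
  refine squeeze_zero' (Eventually.of_forall fun θ => norm_nonneg _) ?_ h3
  filter_upwards [M.isOpen.mem_nhds ht] with θ hθ
  have i1 := M.memLp_sqrtDensity hθ
  have i2 := M.memLp_sqrtDensity ht
  -- A negative `K` is possible only on an empty sample space, which carries no probability measure.
  have hK0 : 0 ≤ K ∨ ∀ x : 𝓧, False := by
    by_cases hne : Nonempty 𝓧
    · exact Or.inl ((abs_nonneg _).trans (hK hne.some))
    · exact Or.inr fun x => hne ⟨x⟩
  have hbd : ∀ a : 𝓧 → ℝ, MemLp a 2 ν → MemLp (fun x => f x * a x) 2 ν := fun a ha => by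
    refine (ha.const_mul K).of_le (hf.aestronglyMeasurable.mul ha.1)
      (Eventually.of_forall fun x => ?_)
    rw [norm_mul, norm_mul]
    gcongr
    exact (hK x).trans (le_abs_self K)
  have hsub := hbd _ (i1.sub i2)
  have hadd := i1.add i2
  rw [M.integral_eq hθ, M.integral_eq ht, ← integral_sub]
  rotate_left
  · refine ((hbd _ i1).integrable_mul i1).congr (Eventually.of_forall fun x => ?_)
    simp only [Pi.mul_apply]; ring
  · refine ((hbd _ i2).integrable_mul i2).congr (Eventually.of_forall fun x => ?_)
    simp only [Pi.mul_apply]; ring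
  -- A difference of squares: one factor tends to 0 in `L²` and the other stays bounded.
  have e1 : ∀ x, f x * sqrtDensity P ν θ x ^ 2 - f x * sqrtDensity P ν t x ^ 2 =
      (f x * (sqrtDensity P ν θ - sqrtDensity P ν t) x) *
        (sqrtDensity P ν θ + sqrtDensity P ν t) x := fun x => by
    simp only [Pi.sub_apply, Pi.add_apply]; ring
  simp only [e1]
  rw [Real.norm_eq_abs]
  refine (abs_integral_mul_le hsub hadd).trans ?_
  rw [M.sqrtDensityLp_eq hθ, M.sqrtDensityLp_eq ht, ← MemLp.toLp_sub, ← MemLp.toLp_add,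
    ← norm_toLp_sq hadd, Real.sqrt_sq (norm_nonneg _), ← mul_assoc]
  gcongr
  rcases hK0 with hK0 | hemp
  · rw [Real.sqrt_le_left (by positivity), mul_pow, norm_toLp_sq, ← integral_const_mul]
    refine integral_mono hsub.integrable_sq ((i1.sub i2).integrable_sq.const_mul _) fun x => ?_
    simp only [mul_pow]
    gcongr ?_ * _
    exact sq_le_sq' (abs_le.1 (hK x)).1 (abs_le.1 (hK x)).2
  · have : IsEmpty 𝓧 := ⟨hemp⟩
    have := M.isProbabilityMeasure θ hθ
    exact absurd (measure_univ (μ := P θ)) (by simp [Measure.eq_zero_of_isEmpty])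

end IsHellingerModel

/-! ### Measurability in the parameter, from limits of continuous functions and difference
quotients. -/

section Measurability

variable {d : ℕ} {Θ₀ : Set (Vec d)}

theorem measurable_indicator_of_continuousAt {f : Vec d → ℝ} (hΘ₀ : IsOpen Θ₀)
    (hf : ∀ t ∈ Θ₀, ContinuousAt f t) : Measurable (Θ₀.indicator f) := by
  classical
  rw [← Set.piecewise_eq_indicator]
  exact ContinuousOn.measurable_piecewise (fun t ht => (hf t ht).continuousWithinAt)
    continuousOn_const hΘ₀.measurableSet

theorem measurable_indicator_of_tendsto {f : ℕ → Vec d → ℝ} {g : Vec d → ℝ}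
    (hf : ∀ n, Measurable (Θ₀.indicator (f n)))
    (hlim : ∀ t ∈ Θ₀, Tendsto (fun n => f n t) atTop (𝓝 (g t))) :
    Measurable (Θ₀.indicator g) := by
  refine measurable_of_tendsto_metrizable hf (tendsto_pi_nhds.2 fun t => ?_)
  by_cases ht : t ∈ Θ₀
  · simpa only [Set.indicator_of_mem ht] using hlim t ht
  · simpa only [Set.indicator_of_notMem ht] using tendsto_const_nhds

theorem tendsto_inv_nat_add_one_nhdsNE :
    Tendsto (fun n : ℕ => (1 : ℝ) / ((n : ℝ) + 1)) atTop (𝓝[≠] 0) :=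
  tendsto_nhdsWithin_iff.2 ⟨tendsto_one_div_add_atTop_nhds_zero_nat,
    Eventually.of_forall fun _ => (Nat.one_div_pos_of_nat).ne'⟩

/-- Line derivatives of a measurable function are measurable. -/
theorem measurable_indicator_of_hasDerivAt_line {f f' : Vec d → ℝ} (hΘ₀ : IsOpen Θ₀)
    (hf : Measurable (Θ₀.indicator f)) (v : Vec d)
    (hf' : ∀ t ∈ Θ₀, HasDerivAt (fun s : ℝ => f (t + s • v)) (f' t) 0) :
    Measurable (Θ₀.indicator f') := by
  refine measurable_indicator_of_tendsto (f := fun n t => (1 / ((n : ℝ) + 1))⁻¹ *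
    (Θ₀.indicator f (t + (1 / ((n : ℝ) + 1)) • v) - Θ₀.indicator f t)) (fun n => ?_)
    fun t ht => ?_
  · refine Measurable.indicator ?_ hΘ₀.measurableSet
    have : Measurable fun t : Vec d => t + (1 / ((n : ℝ) + 1)) • v := measurable_id.add_const _
    exact ((hf.comp this).sub hf).const_mul _
  · have h1 := (hf' t ht).tendsto_slope_zero.comp tendsto_inv_nat_add_one_nhdsNE
    refine h1.congr' ?_
    have hc : Tendsto (fun n : ℕ => t + (1 / ((n : ℝ) + 1)) • v) atTop (𝓝 (t + (0 : ℝ) • v)) :=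
      (tendsto_one_div_add_atTop_nhds_zero_nat.smul_const v).const_add t
    rw [zero_smul, add_zero] at hc
    filter_upwards [hc.eventually (hΘ₀.mem_nhds ht)] with n hn
    simp only [Function.comp_def, smul_eq_mul]
    rw [Set.indicator_of_mem hn, Set.indicator_of_mem ht, zero_add, zero_smul, add_zero]

end Measurability

namespace IsHellingerModel

variable {d : ℕ} {𝓧 : Type*} [MeasurableSpace 𝓧] {ν : Measure 𝓧} [SigmaFinite ν]
  {Θ₀ : Set (Vec d)} {P : Vec d → Measure 𝓧} {ξ : Vec d → 𝓧 → Vec d} {θ t : Vec d}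

/-- Expectations are measurable functions of the parameter. -/
theorem measurable_integral (M : IsHellingerModel ν Θ₀ P ξ) {f : 𝓧 → ℝ} (hf : Measurable f)
    (hint : ∀ θ ∈ Θ₀, Integrable f (P θ)) :
    Measurable (Θ₀.indicator fun θ => ∫ x, f x ∂(P θ)) := by
  have hcl : ∀ n : ℕ, Measurable fun x => max (-(n : ℝ)) (min (f x) n) := fun n =>
    measurable_const.max (hf.min measurable_const)
  refine measurable_indicator_of_tendsto
    (f := fun n θ => ∫ x, max (-(n : ℝ)) (min (f x) n) ∂(P θ)) (fun n => ?_) fun θ hθ => ?_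
  · refine measurable_indicator_of_continuousAt M.isOpen fun t ht =>
      M.continuousAt_integral_of_bounded ht (hcl n) (K := n) fun x => ?_
    rw [abs_le]
    exact ⟨le_max_left _ _, max_le (by linarith [Nat.cast_nonneg (α := ℝ) n]) (min_le_right _ _)⟩
  · refine tendsto_integral_of_dominated_convergence (fun x => |f x|)
      (fun n => (hcl n).aestronglyMeasurable) (hint θ hθ).abs
      (fun n => Eventually.of_forall fun x => ?_) (Eventually.of_forall fun x => ?_)
    · rw [Real.norm_eq_abs, abs_le]
      have hn : (0 : ℝ) ≤ n := Nat.cast_nonneg n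
      refine ⟨?_, max_le (by linarith [abs_nonneg (f x)]) ((min_le_left _ _).trans (le_abs_self _))⟩
      rcases le_total (f x) n with h | h
      · exact le_max_of_le_right (by rw [min_eq_left h]; exact neg_abs_le _)
      · exact le_max_of_le_right (by rw [min_eq_right h]; linarith [abs_nonneg (f x)])
    · refine tendsto_const_nhds.congr' ?_
      filter_upwards [tendsto_natCast_atTop_atTop.eventually_ge_atTop (|f x|)] with n hn
      rw [min_eq_left ((le_abs_self _).trans hn), max_eq_right (by linarith [neg_abs_le (f x)])]

/-- The second moments of the scores are measurable functions of the parameter. -/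
theorem measurable_integral_inner_score_sq (M : IsHellingerModel ν Θ₀ P ξ) (v : Vec d) :
    Measurable (Θ₀.indicator fun t => ∫ x, inner ℝ v (ξ t x) ^ 2 ∂ν) := by
  set w : ℕ → Vec d := fun n => (1 / ((n : ℝ) + 1)) • v
  -- Nothing is assumed on how `ξ t` depends on `t`. Its second moments are limits of squared norms
  -- of difference quotients, which are continuous in `t`.
  set F : ℕ → Vec d → ℝ := fun n t =>
    ‖(1 / ((n : ℝ) + 1))⁻¹ • (sqrtDensityLp P ν (t + w n) - sqrtDensityLp P ν t)‖ ^ 2 with hF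
  have hopen : ∀ n, IsOpen {t | t ∈ Θ₀ ∧ t + w n ∈ Θ₀} := fun n =>
    M.isOpen.inter (M.isOpen.preimage (continuous_id.add continuous_const))
  have hcont : ∀ n, ∀ t ∈ {t | t ∈ Θ₀ ∧ t + w n ∈ Θ₀}, ContinuousAt (F n) t := by
    intro n t ht
    have h1 : ContinuousAt (fun t => sqrtDensityLp P ν (t + w n)) t :=
      ContinuousAt.comp (f := fun t => t + w n) (M.continuousAt_sqrtDensityLp ht.2)
        (continuous_id.add continuous_const).continuousAt
    have h2 := (h1.sub (M.continuousAt_sqrtDensityLp ht.1)).const_smul ((1 / ((n : ℝ) + 1))⁻¹)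
    have h3 := h2.norm
    exact h3.pow 2
  refine measurable_indicator_of_tendsto
    (f := fun n => {t | t ∈ Θ₀ ∧ t + w n ∈ Θ₀}.indicator (F n))
    (fun n => (measurable_indicator_of_continuousAt (hopen n) (hcont n)).indicator
      M.isOpen.measurableSet) fun t ht => ?_
  · have h1 := (M.hasDerivAt_sqrtDensityLp_line ht v).tendsto_slope_zero.comp
      tendsto_inv_nat_add_one_nhdsNE
    have h2 := (h1.norm).pow 2
    rw [norm_toLp_sq] at h2
    refine h2.congr' ?_
    have h0 : Tendsto (fun n : ℕ => (1 : ℝ) / ((n : ℝ) + 1)) atTop (𝓝 0) :=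
      tendsto_one_div_add_atTop_nhds_zero_nat
    filter_upwards [h0.eventually (M.eventually_mem_line ht v)] with n hn
    rw [Set.indicator_of_mem (show t ∈ {t | t ∈ Θ₀ ∧ t + w n ∈ Θ₀} from ⟨ht, hn⟩)]
    simp only [Function.comp_def, hF]
    rw [zero_add, zero_smul, add_zero]

end IsHellingerModel

/-! ### Differentiability of expectations under bounded risk. -/

/-- `S` has, uniformly over the model, a bounded mean squared deviation from some constants. -/
def HasBoundedRisk {d : ℕ} {𝓧 : Type*} [MeasurableSpace 𝓧] (P : Vec d → Measure 𝓧)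
    (Θ₀ : Set (Vec d)) (S : 𝓧 → ℝ) (R : ℝ) : Prop :=
  ∀ θ ∈ Θ₀, ∃ a : ℝ, Integrable (fun x => (S x - a) ^ 2) (P θ) ∧ ∫ x, (S x - a) ^ 2 ∂(P θ) ≤ R

namespace IsHellingerModel

variable {d : ℕ} {𝓧 : Type*} [MeasurableSpace 𝓧] {ν : Measure 𝓧}
  {Θ₀ : Set (Vec d)} {P : Vec d → Measure 𝓧} {ξ : Vec d → 𝓧 → Vec d} {θ t : Vec d}
  {S : 𝓧 → ℝ} {R : ℝ}

theorem memLp_of_hasBoundedRisk (M : IsHellingerModel ν Θ₀ P ξ) (hS : Measurable S)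
    (hR : HasBoundedRisk P Θ₀ S R) (hθ : θ ∈ Θ₀) : MemLp S 2 (P θ) := by
  have := M.isProbabilityMeasure θ hθ
  obtain ⟨a, ha, -⟩ := hR θ hθ
  have h1 : MemLp (fun x => S x - a) 2 (P θ) :=
    (memLp_two_iff_integrable_sq (hS.sub_const a).aestronglyMeasurable).2 ha
  have h2 := h1.add (memLp_const a)
  refine h2.congr_norm hS.aestronglyMeasurable (Eventually.of_forall fun x => ?_)
  simp

variable [SigmaFinite ν]

/-- Second moments are locally bounded as soon as the risk is bounded. -/
theorem eventually_integral_sq_le (M : IsHellingerModel ν Θ₀ P ξ) (hS : Measurable S)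
    (hR : HasBoundedRisk P Θ₀ S R) (ht : t ∈ Θ₀) :
    ∃ C, ∀ᶠ θ in 𝓝 t, ∫ x, S x ^ 2 ∂(P θ) ≤ C := by
  have := M.isProbabilityMeasure t ht
  set f : ℕ → 𝓧 → ℝ := fun n => {x | |S x| ≤ n}.indicator fun _ => 1 with hf
  have hms : ∀ n : ℕ, MeasurableSet {x | |S x| ≤ n} := fun n =>
    measurableSet_le (by fun_prop) measurable_const
  have hfm : ∀ n, Measurable (f n) := fun n => measurable_const.indicator (hms n)
  have hf1 : ∀ n x, |f n x| ≤ 1 := fun n x => by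
    simp only [hf, Set.indicator]
    split_ifs <;> simp
  have hlim : Tendsto (fun n => ∫ x, f n x ∂(P t)) atTop (𝓝 (∫ _, (1 : ℝ) ∂(P t))) := by
    refine tendsto_integral_of_dominated_convergence (fun _ => 1)
      (fun n => (hfm n).aestronglyMeasurable) (integrable_const 1)
      (fun n => Eventually.of_forall (hf1 n)) (Eventually.of_forall fun x => ?_)
    refine tendsto_const_nhds.congr' ?_
    filter_upwards [tendsto_natCast_atTop_atTop.eventually_ge_atTop (|S x|)] with n hn
    rw [hf]
    exact (Set.indicator_of_mem (show x ∈ {x | |S x| ≤ n} from hn) fun _ => (1 : ℝ)).symm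
  simp only [integral_const, probReal_univ, smul_eq_mul, mul_one] at hlim
  obtain ⟨n, hn⟩ := (hlim.eventually (lt_mem_nhds (show (1 / 2 : ℝ) < 1 by norm_num))).exists
  have hcont := M.continuousAt_integral_of_bounded ht (hfm n) (hf1 n)
  -- On `{|S| ≤ n}` one has `a² ≤ 2n² + 2(S - a)²`. This event has probability above 1/2 near `t`,
  -- so integrating gives `a² ≤ 4n² + 4R`; then `E S² ≤ 2R + 2a²`.
  refine ⟨2 * R + 2 * (4 * n ^ 2 + 4 * R), ?_⟩
  filter_upwards [hcont.eventually (lt_mem_nhds hn), M.isOpen.mem_nhds ht] with θ hθn hθ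
  have := M.isProbabilityMeasure θ hθ
  obtain ⟨a, ha, haR⟩ := hR θ hθ
  have hfi : Integrable (f n) (P θ) :=
    (integrable_const (1 : ℝ)).mono' (hfm n).aestronglyMeasurable (Eventually.of_forall (hf1 n))
  have h1 : ∫ x, a ^ 2 * f n x ∂(P θ) ≤ ∫ x, (2 * (n : ℝ) ^ 2 + 2 * (S x - a) ^ 2) ∂(P θ) := by
    refine integral_mono (hfi.const_mul _) ((integrable_const _).add (ha.const_mul 2)) fun x => ?_
    simp only [hf]
    by_cases hx : x ∈ {x | |S x| ≤ n}
    · rw [Set.indicator_of_mem hx]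
      have : S x ^ 2 ≤ (n : ℝ) ^ 2 := sq_le_sq' (abs_le.1 hx).1 (abs_le.1 hx).2
      nlinarith [sq_nonneg (S x + (S x - a))]
    · rw [Set.indicator_of_notMem hx, mul_zero]
      positivity
  rw [integral_const_mul, integral_add (integrable_const _) (ha.const_mul 2),
    integral_const, probReal_univ, one_smul, integral_const_mul] at h1
  have h2 : ∫ x, S x ^ 2 ∂(P θ) ≤ ∫ x, (2 * (S x - a) ^ 2 + 2 * a ^ 2) ∂(P θ) := by
    refine integral_mono (M.memLp_of_hasBoundedRisk hS hR hθ).integrable_sq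
      ((ha.const_mul 2).add (integrable_const _)) fun x => ?_
    simp only
    nlinarith [sq_nonneg (S x - a - a)]
  rw [integral_add (ha.const_mul 2) (integrable_const _), integral_const_mul,
    integral_const, probReal_univ, one_smul] at h2
  have h3 := mul_le_mul_of_nonneg_left hθn.le (sq_nonneg a)
  linarith

/-- Expectations are differentiable along lines. -/
theorem hasDerivAt_integral_line (M : IsHellingerModel ν Θ₀ P ξ) (hS : Measurable S)
    (hR : HasBoundedRisk P Θ₀ S R) (ht : t ∈ Θ₀) (v : Vec d) :
    HasDerivAt (fun s : ℝ => ∫ x, S x ∂(P (t + s • v)))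
      (2 * ∫ x, S x * sqrtDensity P ν t x * inner ℝ v (ξ t x) ∂ν) 0 := by
  have hmem := M.eventually_mem_line ht v
  obtain ⟨C, hC⟩ := M.eventually_integral_sq_le hS hR ht
  have hline : Tendsto (fun s : ℝ => t + s • v) (𝓝 0) (𝓝 t) := by
    have : Tendsto (fun s : ℝ => t + s • v) (𝓝 0) (𝓝 (t + (0 : ℝ) • v)) :=
      (continuous_const.add (continuous_id.smul continuous_const)).tendsto 0
    rwa [zero_smul, add_zero] at this
  have h0 : t + (0 : ℝ) • v = t := by rw [zero_smul, add_zero]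
  have key := hasDerivAt_integral_mul_sq (ν := ν) (S := S)
    (a := fun s : ℝ => sqrtDensity P ν (t + s • v)) (ρ := fun x => inner ℝ v (ξ t x)) (C := C) hS
    (M.memLp_inner_score ht v) (hmem.mono fun s hs => M.memLp_sqrtDensity hs)
    (hmem.mono fun s hs => M.memLp_mul_sqrtDensity hs hS
      (M.memLp_of_hasBoundedRisk hS hR hs).integrable_sq)
    (by
      filter_upwards [hmem, hline.eventually hC] with s hs hsC
      rw [M.integral_eq hs] at hsC
      simpa only [mul_pow] using hsC)
    (by simpa only [h0] using M.tendsto_integral_sqrtDensity_sub_sq ht v)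
    (by simpa only [h0] using M.isLittleO_line ht v)
  rw [h0] at key
  refine key.congr_of_eventuallyEq ?_
  filter_upwards [hmem] with s hs
  exact M.integral_eq hs S

/-- The score is centred. -/
theorem integral_sqrtDensity_mul_inner_score (M : IsHellingerModel ν Θ₀ P ξ) (ht : t ∈ Θ₀)
    (v : Vec d) : ∫ x, sqrtDensity P ν t x * inner ℝ v (ξ t x) ∂ν = 0 := by
  -- The derivative of the total mass, computed in two ways.
  have hR : HasBoundedRisk P Θ₀ (fun _ => (1 : ℝ)) 0 := fun θ _ => ⟨1, by simp⟩
  have h1 := M.hasDerivAt_integral_line measurable_const hR ht v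
  have h2 : HasDerivAt (fun s : ℝ => ∫ _, (1 : ℝ) ∂(P (t + s • v))) 0 0 := by
    refine (hasDerivAt_const (0 : ℝ) (1 : ℝ)).congr_of_eventuallyEq ?_
    filter_upwards [M.eventually_mem_line ht v] with s hs
    have := M.isProbabilityMeasure _ hs
    simp
  have h3 := h1.unique h2
  simpa using h3

end IsHellingerModel

/-! ### Integration against a nice prior, and quadratic forms of the Fisher information. -/

namespace IsNicePrior

variable {d k : ℕ} {Θ₀ : Set (Vec d)} {I : Vec d → Matrix (Fin d) (Fin d) ℝ} {φ : Vec d → Vec k}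
  {Q : Measure (Vec d)} {q : Vec d → ℝ}

theorem integrable_iff (h : IsNicePrior Θ₀ I φ Q q) (hΘ₀ : IsOpen Θ₀) {f : Vec d → ℝ} :
    Integrable f Q ↔ IntegrableOn (fun t => f t * q t) Θ₀ := by
  have hm : AEMeasurable (fun t => ENNReal.ofReal (q t)) (volume.restrict Θ₀) :=
    h.aemeasurable_density.ennreal_ofReal
  conv_lhs => rw [h.eq_withDensity]
  rw [integrable_withDensity_iff_integrable_smul₀' hm
    (Eventually.of_forall fun _ => ENNReal.ofReal_lt_top)]
  refine integrable_congr ?_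
  filter_upwards [ae_restrict_mem hΘ₀.measurableSet] with t ht
  rw [ENNReal.toReal_ofReal (h.density_nonneg t ht), smul_eq_mul, mul_comm]

theorem integral_eq (h : IsNicePrior Θ₀ I φ Q q) (hΘ₀ : IsOpen Θ₀) (f : Vec d → ℝ) :
    ∫ t, f t ∂Q = ∫ t in Θ₀, f t * q t := by
  have hm : AEMeasurable (fun t => ENNReal.ofReal (q t)) (volume.restrict Θ₀) :=
    h.aemeasurable_density.ennreal_ofReal
  conv_lhs => rw [h.eq_withDensity]
  rw [integral_withDensity_eq_integral_toReal_smul₀ hm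
    (Eventually.of_forall fun _ => ENNReal.ofReal_lt_top)]
  refine integral_congr_ae ?_
  filter_upwards [ae_restrict_mem hΘ₀.measurableSet] with t ht
  rw [ENNReal.toReal_ofReal (h.density_nonneg t ht), smul_eq_mul, mul_comm]

theorem absolutelyContinuous (h : IsNicePrior Θ₀ I φ Q q) : Q ≪ volume.restrict Θ₀ := by
  rw [h.eq_withDensity]
  exact withDensity_absolutelyContinuous _ _

theorem ae_mem (h : IsNicePrior Θ₀ I φ Q q) (hΘ₀ : IsOpen Θ₀) : ∀ᵐ t ∂Q, t ∈ Θ₀ :=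
  h.absolutelyContinuous.ae_le (ae_restrict_mem hΘ₀.measurableSet)

/-- The partial derivatives of the density vanish where the density does. -/
theorem partialDeriv_eq_zero (h : IsNicePrior Θ₀ I φ Q q) (hΘ₀ : IsOpen Θ₀) {t : Vec d}
    (ht : t ∈ Θ₀) (hq : ¬ 0 < q t) (i : Fin d) : partialDeriv q i t = 0 := by
  have hmin : IsLocalMin (fun s : ℝ => q (t + s • basisVec i)) 0 := by
    have hc : Tendsto (fun s : ℝ => t + s • (basisVec i : Vec d)) (𝓝 0)
        (𝓝 (t + (0 : ℝ) • basisVec i)) :=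
      (continuous_const.add (continuous_id.smul continuous_const)).tendsto 0
    rw [zero_smul, add_zero] at hc
    filter_upwards [hc.eventually (hΘ₀.mem_nhds ht)] with s hs
    rw [zero_smul, add_zero]
    exact (not_lt.1 hq).trans (h.density_nonneg _ hs)
  exact hmin.deriv_eq_zero

/-- Valid also where `q = 0`, since `q` is minimal there. No mass of `∂ᵢq` is lost when the prior
score is defined only on `{q > 0}`. -/
theorem partialDeriv_eq (h : IsNicePrior Θ₀ I φ Q q) (hΘ₀ : IsOpen Θ₀) {t : Vec d}
    (ht : t ∈ Θ₀) (i : Fin d) : partialDeriv q i t = √(q t) * rootScore q i t := by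
  by_cases hq : 0 < q t
  · rw [rootScore, if_pos hq, mul_div_cancel₀ _ (Real.sqrt_pos.2 hq).ne']
  · rw [rootScore, if_neg hq, mul_zero, h.partialDeriv_eq_zero hΘ₀ ht hq]

theorem priorFisherInfo_eq (i j : Fin d) :
    priorFisherInfo Θ₀ q i j = ∫ t in Θ₀, rootScore q i t * rootScore q j t := by
  simp only [priorFisherInfo, Matrix.of_apply]
  congr 1
  ext t
  by_cases hq : 0 < q t
  · simp only [rootScore, if_pos hq]
    rw [div_mul_div_comm, Real.mul_self_sqrt hq.le]
  · simp only [rootScore, if_neg hq, mul_zero]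

end IsNicePrior

theorem aestronglyMeasurable_of_measurable_indicator {d : ℕ} {Θ₀ : Set (Vec d)} {f : Vec d → ℝ}
    (hΘ₀ : IsOpen Θ₀) (hf : Measurable (Θ₀.indicator f)) :
    AEStronglyMeasurable f (volume.restrict Θ₀) :=
  (aestronglyMeasurable_indicator_iff hΘ₀.measurableSet).1 hf.aestronglyMeasurable

/-- Quadratic form of the Fisher information of the model. -/
theorem dotProduct_fisherInfo_mulVec {d : ℕ} {𝓧 : Type*} [MeasurableSpace 𝓧] {ν : Measure 𝓧}
    {ξ : 𝓧 → Vec d} (hξ : MemLp ξ 2 ν) (c : Fin d → ℝ) :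
    c ⬝ᵥ fisherInfo ν ξ *ᵥ c = 4 * ∫ x, inner ℝ (WithLp.toLp 2 c : Vec d) (ξ x) ^ 2 ∂ν := by
  have hξi : ∀ i, MemLp (fun x => ξ x i) 2 ν := fun i => hξ.eval_piLp i
  have e : ∀ x, inner ℝ (WithLp.toLp 2 c : Vec d) (ξ x) ^ 2 =
      ∑ i, ∑ j, c i * c j * (ξ x i * ξ x j) := by
    intro x
    rw [PiLp.inner_apply, sq, Finset.sum_mul_sum]
    refine Finset.sum_congr rfl fun i _ => Finset.sum_congr rfl fun j _ => ?_
    simp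
    ring
  simp only [e]
  have hint : ∀ i j, Integrable (fun x => c i * c j * (ξ x i * ξ x j)) ν := fun i j =>
    ((hξi i).integrable_mul (hξi j)).const_mul _
  rw [integral_finsetSum _ fun i _ => integrable_finsetSum _ fun j _ => hint i j]
  simp only [dotProduct, Matrix.mulVec, Finset.mul_sum, fisherInfo, Matrix.of_apply]
  refine Finset.sum_congr rfl fun i _ => ?_
  rw [integral_finsetSum _ fun j _ => hint i j, Finset.mul_sum]
  refine Finset.sum_congr rfl fun j _ => ?_
  rw [integral_const_mul]
  ring

/-- Cauchy–Schwarz and the arithmetic–geometric mean inequality. Integrability of the trace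
therefore controls every entry. -/
theorem abs_fisherInfo_le_trace {d : ℕ} {𝓧 : Type*} [MeasurableSpace 𝓧] {ν : Measure 𝓧}
    {ξ : 𝓧 → Vec d} (hξ : MemLp ξ 2 ν) (i j : Fin d) :
    |fisherInfo ν ξ i j| ≤ (fisherInfo ν ξ).trace := by
  have hi : ∀ i, MemLp (fun x => ξ x i) 2 ν := fun i => hξ.eval_piLp i
  have hnn : ∀ l, 0 ≤ ∫ x, ξ x l * ξ x l ∂ν := fun l => integral_nonneg fun x => mul_self_nonneg _
  have hle : ∀ l, 4 * ∫ x, ξ x l * ξ x l ∂ν ≤ (fisherInfo ν ξ).trace := fun l =>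
    Finset.single_le_sum (f := fun l => 4 * ∫ x, ξ x l * ξ x l ∂ν)
      (fun l _ => mul_nonneg zero_le_four (hnn l)) (Finset.mem_univ l)
  have h := abs_integral_mul_le (hi i) (hi j)
  simp only [sq] at h
  have he : fisherInfo ν ξ i j = 4 * ∫ x, ξ x i * ξ x j ∂ν := rfl
  rw [he, abs_mul, abs_of_pos (zero_lt_four' ℝ)]
  have h1 := Real.sq_sqrt (hnn i)
  have h2 := Real.sq_sqrt (hnn j)
  have h3 := hle i
  have h4 := hle j
  nlinarith [sq_nonneg (√(∫ x, ξ x i * ξ x i ∂ν) - √(∫ x, ξ x j * ξ x j ∂ν))]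

/-! ### The inequality in `L²(ν)` at a fixed parameter. -/

section ScoreInequality

variable {d k : ℕ} {𝓧 : Type*} [MeasurableSpace 𝓧] {ν : Measure 𝓧} [SigmaFinite ν]
  {Θ₀ : Set (Vec d)} {P : Vec d → Measure 𝓧} {ξ : Vec d → 𝓧 → Vec d} {t : Vec d}
  {φ : Vec d → Vec k} {Q : Measure (Vec d)} {q : Vec d → ℝ}

theorem inner_basisVec (i : Fin d) (v : Vec d) : inner ℝ (basisVec i) v = v i := by
  simp [basisVec, EuclideanSpace.inner_single_left]

/-- Polarisation of the second moments of the scores. It produces `2 ∫ ξᵢ ξⱼ`; a further factor 2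
gives the 4 of the Fisher information. -/
theorem IsHellingerModel.measurable_fisherInfo (M : IsHellingerModel ν Θ₀ P ξ) (i j : Fin d) :
    Measurable (Θ₀.indicator fun t => fisherInfo ν (ξ t) i j) := by
  have hq : ∀ v : Vec d, Measurable (Θ₀.indicator fun t => ∫ x, inner ℝ v (ξ t x) ^ 2 ∂ν) :=
    M.measurable_integral_inner_score_sq
  have h1 := (((hq (basisVec i + basisVec j)).sub (hq (basisVec i))).sub
    (hq (basisVec j))).const_mul 2
  convert! h1 using 1
  ext t
  by_cases ht : t ∈ Θ₀
  · simp only [Pi.sub_apply, Set.indicator_of_mem ht, inner_add_left, inner_basisVec, fisherInfo,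
      Matrix.of_apply]
    have hi := M.memLp_score ht i
    have hj := M.memLp_score ht j
    have e : ∫ x, (ξ t x i + ξ t x j) ^ 2 ∂ν = ∫ x, ξ t x i ^ 2 ∂ν + 2 * ∫ x, ξ t x i * ξ t x j ∂ν +
        ∫ x, ξ t x j ^ 2 ∂ν := by
      have hij : Integrable (fun x => 2 * (ξ t x i * ξ t x j)) ν :=
        (hi.integrable_mul hj).const_mul 2
      rw [← integral_const_mul, ← integral_add hi.integrable_sq hij]
      refine Eq.trans ?_ (integral_add (hi.integrable_sq.add hij) hj.integrable_sq)
      congr 1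
      ext x
      ring
    rw [e]
    ring
  · simp only [Pi.sub_apply, Set.indicator_of_notMem ht]
    simp

theorem IsHellingerModel.integrable_fisherInfo (M : IsHellingerModel ν Θ₀ P ξ)
    (h : IsNicePrior Θ₀ (fun t => fisherInfo ν (ξ t)) φ Q q) (i j : Fin d) :
    Integrable (fun t => fisherInfo ν (ξ t) i j) Q := by
  refine h.integrable_trace.mono' ((aestronglyMeasurable_of_measurable_indicator M.isOpen
    (M.measurable_fisherInfo i j)).mono_ac h.absolutelyContinuous) ?_
  filter_upwards [h.ae_mem M.isOpen] with t ht
  exact abs_fisherInfo_le_trace (M.hasHellingerDerivAt t ht).1 i j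

/-- Abstract pointwise inequality behind the van Trees inequality. -/
theorem two_mul_inner_le {H : Type*} [NormedAddCommGroup H] [InnerProductSpace ℝ H] (u w σ : H)
    (hσ : ‖σ‖ ^ 2 = 1) (hσw : inner ℝ σ w = 0) (τ ρ : ℝ) :
    2 * (2 * inner ℝ u w * τ ^ 2 + inner ℝ u σ * (τ * ρ)) ≤
      ‖u‖ ^ 2 * τ ^ 2 + 4 * ‖w‖ ^ 2 * τ ^ 2 + ρ ^ 2 := by
  have hwσ : inner ℝ w σ = 0 := by rw [real_inner_comm, hσw]
  -- In the application `τ = √q`, `u = (S - g) √p_t`, `σ = √p_t`, `w` is the Hellinger score in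
  -- direction `c` and `ρ` the prior score in that direction. The cross term of `w` and `σ`
  -- vanishes.
  have h := sq_nonneg ‖τ • u - ((2 * τ) • w + ρ • σ)‖
  rw [norm_sub_sq_real, norm_add_sq_real, inner_add_right, norm_smul, norm_smul, norm_smul,
    real_inner_smul_left, real_inner_smul_left, real_inner_smul_left, real_inner_smul_right,
    real_inner_smul_right, real_inner_smul_right, hwσ, mul_pow, mul_pow, mul_pow,
    hσ, Real.norm_eq_abs, Real.norm_eq_abs, Real.norm_eq_abs, sq_abs, sq_abs, sq_abs] at h
  linarith

variable {S : 𝓧 → ℝ} {R : ℝ} {g : Vec d → ℝ}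

/-- Dictionary between statistics and `L²(ν)`, with `u = (S - b) √p_t`, `σ = √p_t`, `w = vᵀξ_t`. In
the last identity `b` disappears because the score is centred. -/
theorem IsHellingerModel.exists_inner_eq (M : IsHellingerModel ν Θ₀ P ξ) (hS : Measurable S)
    (hR : HasBoundedRisk P Θ₀ S R) (ht : t ∈ Θ₀) (b : ℝ) :
    ∃ u σ : Lp ℝ 2 ν, ‖u‖ ^ 2 = ∫ x, (S x - b) ^ 2 ∂(P t) ∧ ‖σ‖ ^ 2 = 1 ∧
      inner ℝ u σ = ∫ x, S x ∂(P t) - b ∧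
      ∀ v : Vec d, ∃ w : Lp ℝ 2 ν, ‖w‖ ^ 2 = ∫ x, inner ℝ v (ξ t x) ^ 2 ∂ν ∧ inner ℝ σ w = 0 ∧
        inner ℝ u w = ∫ x, S x * sqrtDensity P ν t x * inner ℝ v (ξ t x) ∂ν := by
  have := M.isProbabilityMeasure t ht
  have hS2 := M.memLp_of_hasBoundedRisk hS hR ht
  have hSb : MemLp (fun x => S x - b) 2 (P t) := hS2.sub (memLp_const b)
  have hu := M.memLp_mul_sqrtDensity ht (hS.sub_const b) hSb.integrable_sq
  have hσ := M.memLp_sqrtDensity ht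
  have hSσ := M.memLp_mul_sqrtDensity ht hS hS2.integrable_sq
  refine ⟨hu.toLp _, hσ.toLp _, ?_, ?_, ?_, fun v => ⟨(M.memLp_inner_score ht v).toLp _, ?_, ?_, ?_⟩⟩
  · rw [norm_toLp_sq, M.integral_eq ht]
    simp only [mul_pow]
  · rw [norm_toLp_sq]
    have := M.integral_eq ht fun _ => 1
    simpa using this.symm
  · rw [inner_toLp_toLp]
    have h1 := M.integral_eq ht fun x => S x - b
    rw [integral_sub (hS2.integrable one_le_two) (integrable_const b), integral_const,
      probReal_univ, one_smul] at h1
    rw [h1]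
    congr 1
    ext x
    ring
  · rw [norm_toLp_sq]
  · rw [inner_toLp_toLp, M.integral_sqrtDensity_mul_inner_score ht]
  · rw [inner_toLp_toLp]
    have hw := M.memLp_inner_score ht v
    have h0 := M.integral_sqrtDensity_mul_inner_score ht v
    have h1 : ∫ x, (S x * sqrtDensity P ν t x * inner ℝ v (ξ t x) -
        b * (sqrtDensity P ν t x * inner ℝ v (ξ t x))) ∂ν =
        (∫ x, S x * sqrtDensity P ν t x * inner ℝ v (ξ t x) ∂ν) -
        ∫ x, b * (sqrtDensity P ν t x * inner ℝ v (ξ t x)) ∂ν :=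
      integral_sub (hSσ.integrable_mul hw) ((hσ.integrable_mul hw).const_mul b)
    rw [integral_const_mul, h0, mul_zero, sub_zero] at h1
    rw [← h1]
    congr 1
    ext x
    ring

end ScoreInequality

/-! ### The van Trees inequality for a real statistic. -/

section VanTrees

variable {d k : ℕ} {𝓧 : Type*} [MeasurableSpace 𝓧] {ν : Measure 𝓧} [SigmaFinite ν]
  {Θ₀ : Set (Vec d)} {P : Vec d → Measure 𝓧} {ξ : Vec d → 𝓧 → Vec d} {t : Vec d}
  {φ : Vec d → Vec k} {Q : Measure (Vec d)} {q : Vec d → ℝ}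
  {S : 𝓧 → ℝ} {R : ℝ} {g : Vec d → ℝ}

/-- The part `(∂ᵢ E_t S) q + (E_t S - g) ∂ᵢ q` of the derivative of `(E_t S - g) q`. -/
noncomputable def biasFlux (P : Vec d → Measure 𝓧) (ν : Measure 𝓧) (ξ : Vec d → 𝓧 → Vec d)
    (q : Vec d → ℝ) (S : 𝓧 → ℝ) (g : Vec d → ℝ) (i : Fin d) (t : Vec d) : ℝ :=
  2 * (∫ x, S x * sqrtDensity P ν t x * inner ℝ (basisVec i) (ξ t x) ∂ν) * q t +
    (∫ x, S x ∂(P t) - g t) * partialDeriv q i t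

/-- Integration by parts of the prior against the bias of a statistic. -/
theorem integral_partialDeriv_eq (M : IsHellingerModel ν Θ₀ P ξ)
    (h : IsNicePrior Θ₀ (fun t => fisherInfo ν (ξ t)) φ Q q) (hS : Measurable S)
    (hR : HasBoundedRisk P Θ₀ S R) (hg : IsAbsCont Θ₀ g) (hgQ : Integrable g Q) (i : Fin d)
    (hg' : Integrable (partialDeriv g i) Q)
    (hV : Integrable (fun t => ∫ x, (S x - g t) ^ 2 ∂(P t)) Q) :
    IntegrableOn (fun t => biasFlux P ν ξ q S g i t) Θ₀ ∧
    ∫ t, partialDeriv g i t ∂Q = ∫ t in Θ₀, biasFlux P ν ξ q S g i t := by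
  have := h.isProbabilityMeasure
  have hΘ := M.isOpen
  set m : Vec d → ℝ := fun t => ∫ x, S x ∂(P t) with hm
  set m' : Vec d → ℝ := fun t =>
    2 * ∫ x, S x * sqrtDensity P ν t x * inner ℝ (basisVec i) (ξ t x) ∂ν with hm'
  set V : Vec d → ℝ := fun t => ∫ x, (S x - g t) ^ 2 ∂(P t) with hVdef
  have hderiv : ∀ t ∈ Θ₀, HasDerivAt (fun s : ℝ => m (t + s • basisVec i)) (m' t) 0 :=
    fun t ht => M.hasDerivAt_integral_line hS hR ht _
  have hmm : Measurable (Θ₀.indicator m) :=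
    M.measurable_integral hS fun θ hθ => by
      have := M.isProbabilityMeasure θ hθ
      exact (M.memLp_of_hasBoundedRisk hS hR hθ).integrable one_le_two
  have hm'm := measurable_indicator_of_hasDerivAt_line hΘ hmm (basisVec i) hderiv
  have hVq : IntegrableOn (fun t => V t * q t) Θ₀ := (h.integrable_iff hΘ).1 hV
  -- This bound and the next come from Cauchy–Schwarz in `L²(ν)`; with the integrability of `V` and
  -- of the Fisher information they yield all the integrability that integration by parts requires.
  have hb1 : ∀ t ∈ Θ₀, (m t - g t) ^ 2 ≤ V t := by
    intro t ht
    obtain ⟨u, σ, hu, hσ, huσ, -⟩ := M.exists_inner_eq hS hR ht (g t)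
    have := real_inner_mul_inner_self_le u σ
    rw [real_inner_self_eq_norm_sq, real_inner_self_eq_norm_sq, hσ, mul_one, hu, huσ, ← sq] at this
    exact this
  have hb2 : ∀ t ∈ Θ₀, |m' t| ≤ V t + fisherInfo ν (ξ t) i i := by
    intro t ht
    obtain ⟨u, σ, hu, hσ, huσ, hw⟩ := M.exists_inner_eq hS hR ht (g t)
    obtain ⟨w, hw1, -, hw3⟩ := hw (basisVec i)
    have h1 := abs_real_inner_le_norm u w
    simp only [hm', hVdef]
    have hdiag : fisherInfo ν (ξ t) i i = 4 * ∫ x, inner ℝ (basisVec i) (ξ t x) ^ 2 ∂ν := by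
      simp only [fisherInfo, Matrix.of_apply, inner_basisVec, sq]
    rw [hdiag, ← hw3, ← hu, ← hw1, abs_mul, abs_two]
    nlinarith [sq_nonneg (‖u‖ - ‖w‖), sq_nonneg ‖w‖]
  have hmgQ : Integrable (fun t => m t - g t) Q := by
    refine ((integrable_const (1 : ℝ)).add hV).mono'
      (((aestronglyMeasurable_of_measurable_indicator hΘ hmm).mono_ac h.absolutelyContinuous).sub
        hgQ.1) ?_
    filter_upwards [h.ae_mem hΘ] with t ht
    have := hb1 t ht
    rw [Real.norm_eq_abs, abs_le]
    simp only [Pi.add_apply]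
    constructor <;> nlinarith [sq_nonneg (m t - g t - 1), sq_nonneg (m t - g t + 1)]
  have hm'Q : Integrable m' Q := by
    refine (hV.add (M.integrable_fisherInfo h i i)).mono'
      ((aestronglyMeasurable_of_measurable_indicator hΘ hm'm).mono_ac h.absolutelyContinuous) ?_
    filter_upwards [h.ae_mem hΘ] with t ht using hb2 t ht
  have hmgq := (h.integrable_iff hΘ).1 hmgQ
  have hm'q := (h.integrable_iff hΘ).1 hm'Q
  have hg'q := (h.integrable_iff hΘ).1 hg'
  have hmgq' : IntegrableOn (fun t => (m t - g t) * partialDeriv q i t) Θ₀ := by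
    refine (hVq.add (h.memLp_rootScore i).integrable_sq).mono' ?_ ?_
    -- Written as `((m - g) q) · (rootScore · (√q)⁻¹)`, a product of functions already known to be
    -- measurable; with `0⁻¹ = 0` this is also correct at the zeros of `q`.
    · refine (hmgq.1.mul ((h.memLp_rootScore i).1.mul
        h.aemeasurable_density.sqrt.inv.aestronglyMeasurable)).congr ?_
      filter_upwards [ae_restrict_mem hΘ.measurableSet] with t ht
      simp only [Pi.mul_apply, Pi.inv_apply]
      rw [h.partialDeriv_eq hΘ ht]
      rcases (h.density_nonneg t ht).eq_or_lt with h0 | h0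
      · rw [← h0]; simp
      · have h1 := Real.sqrt_pos.2 h0
        have h2 := Real.sq_sqrt h0.le
        field_simp
        rw [h2]
        ring
    · filter_upwards [ae_restrict_mem hΘ.measurableSet] with t ht
      rw [h.partialDeriv_eq hΘ ht, Real.norm_eq_abs, abs_mul, abs_mul,
        abs_of_nonneg (Real.sqrt_nonneg _)]
      simp only [Pi.add_apply]
      have h1 := mul_le_mul_of_nonneg_right (hb1 t ht) (h.density_nonneg t ht)
      have h2 := Real.sq_sqrt (h.density_nonneg t ht)
      have h3 := sq_abs (m t - g t)
      have h4 := sq_abs (rootScore q i t)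
      have h5 : (|m t - g t| * √(q t)) ^ 2 = (m t - g t) ^ 2 * q t := by rw [mul_pow, h3, h2]
      nlinarith [sq_nonneg (|m t - g t| * √(q t) - |rootScore q i t|),
        sq_nonneg (rootScore q i t), sq_nonneg (|m t - g t| * √(q t))]
  have hsum := hm'q.add hmgq'
  refine ⟨hsum, ?_⟩
  have key := integral_partialDeriv_eq_zero hΘ i h.density_nonneg h.absCont_density hg hderiv
    (fun b hb => h.tendsto_boundary b hb i) hm'q hg'q hmgq hmgq'
  rw [h.integral_eq hΘ]
  have h1 : ∫ t in Θ₀, ((m' t * q t + (m t - g t) * partialDeriv q i t) - partialDeriv g i t * q t)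
      = 0 := by
    rw [← key]
    congr 1
    ext t
    ring
  have h2 : ∫ t in Θ₀, ((m' t * q t + (m t - g t) * partialDeriv q i t) - partialDeriv g i t * q t)
      = (∫ t in Θ₀, (m' t * q t + (m t - g t) * partialDeriv q i t)) -
        ∫ t in Θ₀, partialDeriv g i t * q t := integral_sub hsum hg'q
  exact (sub_eq_zero.1 (h2.symm.trans h1)).symm

theorem dotProduct_priorFisherInfo_mulVec {I : Vec d → Matrix (Fin d) (Fin d) ℝ}
    (h : IsNicePrior Θ₀ I φ Q q) (c : Fin d → ℝ) :
    Integrable (fun t => (∑ i, c i * rootScore q i t) ^ 2) (volume.restrict Θ₀) ∧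
    c ⬝ᵥ priorFisherInfo Θ₀ q *ᵥ c = ∫ t in Θ₀, (∑ i, c i * rootScore q i t) ^ 2 := by
  have e : ∀ t, (∑ i, c i * rootScore q i t) ^ 2 =
      ∑ i, ∑ j, c i * c j * (rootScore q i t * rootScore q j t) := by
    intro t
    rw [sq, Finset.sum_mul_sum]
    exact Finset.sum_congr rfl fun i _ => Finset.sum_congr rfl fun j _ => by ring
  have hint : ∀ i j, Integrable (fun t => c i * c j * (rootScore q i t * rootScore q j t))
      (volume.restrict Θ₀) := fun i j =>
    ((h.memLp_rootScore i).integrable_mul (h.memLp_rootScore j)).const_mul _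
  simp only [e]
  refine ⟨integrable_finsetSum _ fun i _ => integrable_finsetSum _ fun j _ => hint i j, ?_⟩
  rw [integral_finsetSum _ fun i _ => integrable_finsetSum _ fun j _ => hint i j]
  simp only [dotProduct, Matrix.mulVec, Finset.mul_sum]
  refine Finset.sum_congr rfl fun i _ => ?_
  rw [integral_finsetSum _ fun j _ => hint i j]
  refine Finset.sum_congr rfl fun j _ => ?_
  rw [integral_const_mul, IsNicePrior.priorFisherInfo_eq]
  ring

theorem dotProduct_meanInfo_mulVec {I : Vec d → Matrix (Fin d) (Fin d) ℝ}
    (hI : ∀ i j, Integrable (fun t => I t i j) Q) (c : Fin d → ℝ) :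
    Integrable (fun t => c ⬝ᵥ I t *ᵥ c) Q ∧
    c ⬝ᵥ meanInfo I Q *ᵥ c = ∫ t, c ⬝ᵥ I t *ᵥ c ∂Q := by
  have hint : ∀ i j, Integrable (fun t => c i * (I t i j * c j)) Q := fun i j =>
    ((hI i j).mul_const _).const_mul _
  simp only [dotProduct, Matrix.mulVec, Finset.mul_sum]
  refine ⟨integrable_finsetSum _ fun i _ => integrable_finsetSum _ fun j _ => hint i j, ?_⟩
  rw [integral_finsetSum _ fun i _ => integrable_finsetSum _ fun j _ => hint i j]
  refine Finset.sum_congr rfl fun i _ => ?_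
  rw [integral_finsetSum _ fun j _ => hint i j]
  refine Finset.sum_congr rfl fun j _ => ?_
  rw [integral_const_mul, integral_mul_const]
  rfl

/-- The van Trees inequality for a real statistic, in linearised form. -/
theorem two_mul_dotProduct_le (M : IsHellingerModel ν Θ₀ P ξ)
    (h : IsNicePrior Θ₀ (fun t => fisherInfo ν (ξ t)) φ Q q) (hS : Measurable S)
    (hR : HasBoundedRisk P Θ₀ S R)
    (hV : Integrable (fun t => ∫ x, (S x - g t) ^ 2 ∂(P t)) Q) {w : Fin d → ℝ}
    (hw : ∀ i, IntegrableOn (fun t => biasFlux P ν ξ q S g i t) Θ₀ ∧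
      w i = ∫ t in Θ₀, biasFlux P ν ξ q S g i t) (c : Fin d → ℝ) :
    2 * (c ⬝ᵥ w) ≤ ∫ t, ∫ x, (S x - g t) ^ 2 ∂(P t) ∂Q +
      c ⬝ᵥ (priorFisherInfo Θ₀ q + meanInfo (fun t => fisherInfo ν (ξ t)) Q) *ᵥ c := by
  have hΘ := M.isOpen
  set cv : Vec d := WithLp.toLp 2 c with hcv
  obtain ⟨hI1, hI2⟩ := dotProduct_priorFisherInfo_mulVec h c
  obtain ⟨hJ1, hJ2⟩ := dotProduct_meanInfo_mulVec (M.integrable_fisherInfo h) c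
  have hV' := (h.integrable_iff hΘ).1 hV
  have hJ' := (h.integrable_iff hΘ).1 hJ1
  have hVJ : IntegrableOn (fun t => (∫ x, (S x - g t) ^ 2 ∂(P t)) * q t +
      (c ⬝ᵥ fisherInfo ν (ξ t) *ᵥ c) * q t) Θ₀ := hV'.add hJ'
  have hY : IntegrableOn (fun t => ∑ i, c i * biasFlux P ν ξ q S g i t) Θ₀ :=
    integrable_finsetSum _ fun i _ => (hw i).1.const_mul (c i)
  have e1 : c ⬝ᵥ w = ∫ t in Θ₀, ∑ i, c i * biasFlux P ν ξ q S g i t := by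
    rw [integral_finsetSum _ fun i _ => (hw i).1.const_mul (c i)]
    simp only [dotProduct]
    refine Finset.sum_congr rfl fun i _ => ?_
    rw [integral_const_mul, (hw i).2]
  rw [Matrix.add_mulVec, dotProduct_add, hI2, hJ2, h.integral_eq hΘ, h.integral_eq hΘ, e1,
    ← integral_const_mul, add_left_comm, ← integral_add hV' hJ',
    ← integral_add hI1 hVJ]
  -- After everything is written as an integral over `Θ₀`, the inequality holds for each `t`.
  refine setIntegral_mono_on (hY.const_mul 2) (hI1.add hVJ) hΘ.measurableSet
    fun t ht => ?_
  obtain ⟨u, σ, hu, hσ, huσ, hv⟩ := M.exists_inner_eq hS hR ht (g t)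
  obtain ⟨z, hz1, hz2, hz3⟩ := hv cv
  have hξ := (M.hasHellingerDerivAt t ht).1
  have hq2 := Real.sq_sqrt (h.density_nonneg t ht)
  have key := two_mul_inner_le u z σ hσ hz2 (√(q t)) (∑ i, c i * rootScore q i t)
  rw [hu, hz1, hz3, huσ, hq2, ← dotProduct_fisherInfo_mulVec hξ c] at key
  have e2 : ∫ x, S x * sqrtDensity P ν t x * inner ℝ cv (ξ t x) ∂ν =
      ∑ i, c i * ∫ x, S x * sqrtDensity P ν t x * inner ℝ (basisVec i) (ξ t x) ∂ν := by
    have hSσ := M.memLp_mul_sqrtDensity ht hS (M.memLp_of_hasBoundedRisk hS hR ht).integrable_sq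
    simp only [← integral_const_mul]
    have hint : ∀ i, Integrable (fun x => c i * (S x * sqrtDensity P ν t x *
        inner ℝ (basisVec i) (ξ t x))) ν := fun i =>
      (hSσ.integrable_mul (M.memLp_inner_score ht (basisVec i))).const_mul (c i)
    rw [← integral_finsetSum _ fun i _ => hint i]
    congr 1
    ext x
    simp only [inner_basisVec]
    rw [PiLp.inner_apply, Finset.mul_sum]
    refine Finset.sum_congr rfl fun i _ => ?_
    simp [hcv]
    ring
  have e3 : ∑ i, c i * biasFlux P ν ξ q S g i t =
      2 * (∫ x, S x * sqrtDensity P ν t x * inner ℝ cv (ξ t x) ∂ν) * q t +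
      (∫ x, S x ∂(P t) - g t) * (√(q t) * ∑ i, c i * rootScore q i t) := by
    rw [e2, Finset.mul_sum, Finset.sum_mul, Finset.mul_sum, Finset.mul_sum, ← Finset.sum_add_distrib]
    refine Finset.sum_congr rfl fun i _ => ?_
    rw [biasFlux, h.partialDeriv_eq hΘ ht]
    ring
  rw [e3]
  linarith

end VanTrees

/-! ### Norms on `ℝᵏ` and their duals. -/

section Norms

variable {k : ℕ} {N : Seminorm ℝ (Vec k)}

theorem continuous_seminorm (N : Seminorm ℝ (Vec k)) : Continuous N := by
  rw [← continuousOn_univ]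
  exact ConvexOn.continuousOn isOpen_univ N.convexOn

/-- The constant is the minimum of `N` on the compact Euclidean unit sphere, which is empty in the
trivial space. -/
theorem exists_mul_norm_le_seminorm (hN : ∀ v, N v = 0 → v = 0) :
    ∃ c > 0, ∀ x, c * ‖x‖ ≤ N x := by
  rcases subsingleton_or_nontrivial (Vec k) with hs | hn
  · exact ⟨1, one_pos, fun x => by rw [Subsingleton.elim x 0]; simp⟩
  · obtain ⟨x₀, hx₀, hmin⟩ := (isCompact_sphere (0 : Vec k) 1).exists_isMinOn
      (NormedSpace.sphere_nonempty.2 zero_le_one) (continuous_seminorm N).continuousOn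
    have hx₀' : x₀ ≠ 0 := by
      rintro rfl
      simp at hx₀
    have hpos : 0 < N x₀ := (apply_nonneg N x₀).lt_of_ne' fun h => hx₀' (hN _ h)
    refine ⟨N x₀, hpos, fun x => ?_⟩
    rcases eq_or_ne x 0 with rfl | hx
    · simp
    · have hx' : 0 < ‖x‖ := norm_pos_iff.2 hx
      have h1 : N x₀ ≤ N (‖x‖⁻¹ • x) := hmin (by simp [norm_smul, hx'.ne'])
      rw [map_smul_eq_mul, norm_inv, norm_norm, inv_mul_eq_div, le_div_iff₀ hx'] at h1
      exact h1

/-- Linear forms are bounded with respect to any norm. -/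
theorem exists_abs_inner_le (hN : ∀ v, N v = 0 → v = 0) (v : Vec k) :
    ∃ K ≥ 0, ∀ x, |inner ℝ v x| ≤ K * N x := by
  obtain ⟨c, hc, h⟩ := exists_mul_norm_le_seminorm hN
  refine ⟨‖v‖ / c, by positivity, fun x => (abs_real_inner_le_norm v x).trans ?_⟩
  rw [div_mul_eq_mul_div, le_div_iff₀ hc]
  nlinarith [h x, norm_nonneg v, norm_nonneg x]

/-- Homogeneity reduces to `N x = 1`. Definiteness of `N` makes the set in `dualNorm` bounded above;
an unbounded one would have the default supremum 0, and `hu` would say nothing. -/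
theorem abs_inner_le_of_dualNorm_le_one (hN : ∀ v, N v = 0 → v = 0) {u : Vec k}
    (hu : dualNorm N u ≤ 1) (x : Vec k) : |inner ℝ u x| ≤ N x := by
  obtain ⟨K, hK, hb⟩ := exists_abs_inner_le hN u
  have hbdd : BddAbove {r : ℝ | ∃ x : Vec k, N x ≤ 1 ∧ r = inner ℝ u x} := by
    refine ⟨K, ?_⟩
    rintro _ ⟨y, hy, rfl⟩
    exact ((le_abs_self _).trans (hb y)).trans (mul_le_of_le_one_right hK hy)
  have hle : ∀ x, inner ℝ u x ≤ N x := by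
    intro x
    rcases (apply_nonneg N x).eq_or_lt with h0 | h0
    · rw [hN x h0.symm]; simp
    · have h1 : inner ℝ u ((N x)⁻¹ • x) ≤ dualNorm N u := by
        refine le_csSup hbdd ⟨_, ?_, rfl⟩
        rw [map_smul_eq_mul, norm_inv, Real.norm_of_nonneg h0.le, inv_mul_cancel₀ h0.ne']
      have h2 := h1.trans hu
      rw [real_inner_smul_right, inv_mul_eq_div, div_le_one h0] at h2
      exact h2
  refine abs_le.2 ⟨?_, hle x⟩
  have := hle (-x)
  rw [inner_neg_right, map_neg_eq_map] at this
  linarith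

end Norms

/-! ### Passing from the risk for `ψ` to the Bayes risk for the surrogate. -/

section SurrogateRisk

variable {d k : ℕ} {𝓧 : Type*} [MeasurableSpace 𝓧] {ν : Measure 𝓧}
  {Θ₀ : Set (Vec d)} {P : Vec d → Measure 𝓧} {ξ : Vec d → 𝓧 → Vec d}
  {ψ φ : Vec d → Vec k} {Q : Measure (Vec d)} {q : Vec d → ℝ}
  {N : Seminorm ℝ (Vec k)} {T : 𝓧 → Vec k} {R : ℝ≥0∞}

theorem lintegral_add_sq_rpow_le {α : Type*} [MeasurableSpace α] {μ : Measure α} {f g : α → ℝ≥0∞}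
    (hf : AEMeasurable f μ) (hg : AEMeasurable g μ) :
    (∫⁻ a, (f a + g a) ^ 2 ∂μ) ^ (1 / 2 : ℝ) ≤
      (∫⁻ a, f a ^ 2 ∂μ) ^ (1 / 2 : ℝ) + (∫⁻ a, g a ^ 2 ∂μ) ^ (1 / 2 : ℝ) := by
  have := ENNReal.lintegral_Lp_add_le hf hg (p := 2) one_le_two
  simpa only [Pi.add_apply, ENNReal.rpow_two] using this

theorem sq_rpow_half (a : ℝ≥0∞) : (a ^ 2) ^ (1 / 2 : ℝ) = a := by
  rw [← ENNReal.rpow_two, ← ENNReal.rpow_mul]; norm_num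

theorem rpow_half_sq (a : ℝ≥0∞) : (a ^ (1 / 2 : ℝ)) ^ 2 = a := by
  rw [← ENNReal.rpow_two, ← ENNReal.rpow_mul]; norm_num

/-- The risk for estimating the surrogate, at one parameter. -/
theorem lintegral_seminorm_sub_sq_le {μ : Measure 𝓧} [IsProbabilityMeasure μ] (hT : Measurable T)
    {a b : Vec k} (hR : ∫⁻ x, ENNReal.ofReal (N (T x - a) ^ 2) ∂μ ≤ R) :
    ∫⁻ x, ENNReal.ofReal (N (T x - b) ^ 2) ∂μ ≤
      (R ^ (1 / 2 : ℝ) + ENNReal.ofReal (N (a - b))) ^ 2 := by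
  have hm : Measurable fun x => ENNReal.ofReal (N (T x - a)) :=
    ((continuous_seminorm N).measurable.comp (hT.sub_const a)).ennreal_ofReal
  have h1 := lintegral_add_sq_rpow_le (μ := μ) hm.aemeasurable
    (aemeasurable_const (b := ENNReal.ofReal (N (a - b))))
  rw [lintegral_const, measure_univ, mul_one, sq_rpow_half] at h1
  have h2 : ∫⁻ x, ENNReal.ofReal (N (T x - b) ^ 2) ∂μ ≤
      ∫⁻ x, (ENNReal.ofReal (N (T x - a)) + ENNReal.ofReal (N (a - b))) ^ 2 ∂μ := by
    refine lintegral_mono fun x => ?_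
    rw [← ENNReal.ofReal_add (apply_nonneg _ _) (apply_nonneg _ _),
      ← ENNReal.ofReal_pow (add_nonneg (apply_nonneg _ _) (apply_nonneg _ _))]
    refine ENNReal.ofReal_le_ofReal ?_
    gcongr
    calc N (T x - b) = N ((T x - a) + (a - b)) := by rw [sub_add_sub_cancel]
      _ ≤ _ := map_add_le_add N _ _
  refine h2.trans ?_
  rw [← rpow_half_sq (∫⁻ x, (ENNReal.ofReal (N (T x - a)) + ENNReal.ofReal (N (a - b))) ^ 2 ∂μ)]
  gcongr
  refine h1.trans ?_
  gcongr
  refine (lintegral_mono fun x => ?_).trans hR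
  rw [ENNReal.ofReal_pow (apply_nonneg _ _)]

/-- The Bayes risk for estimating the surrogate. -/
theorem lintegral_surrogate_risk_le [IsProbabilityMeasure Q] (hψ : AEMeasurable ψ Q)
    (hφ : AEMeasurable φ Q) :
    ∫⁻ t, (R ^ (1 / 2 : ℝ) + ENNReal.ofReal (N (ψ t - φ t))) ^ 2 ∂Q ≤
      (R ^ (1 / 2 : ℝ) + approxBias N ψ φ Q) ^ 2 := by
  have hm : AEMeasurable (fun t => ENNReal.ofReal (N (ψ t - φ t))) Q :=
    ((continuous_seminorm N).measurable.comp_aemeasurable (hψ.sub hφ)).ennreal_ofReal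
  have h1 := lintegral_add_sq_rpow_le (μ := Q) (aemeasurable_const (b := R ^ (1 / 2 : ℝ))) hm
  rw [lintegral_const, measure_univ, mul_one, sq_rpow_half] at h1
  rw [← rpow_half_sq (∫⁻ t, (R ^ (1 / 2 : ℝ) + ENNReal.ofReal (N (ψ t - φ t))) ^ 2 ∂Q)]
  gcongr
  refine h1.trans ?_
  rw [approxBias]
  simp only [ENNReal.ofReal_pow (apply_nonneg _ _)]
  exact le_rfl

/-- A linear form of an estimator of bounded risk has bounded risk. -/
theorem hasBoundedRisk_inner (hP : ∀ θ ∈ Θ₀, IsProbabilityMeasure (P θ)) (hT : Measurable T)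
    (hR : ∀ θ ∈ Θ₀, ∫⁻ x, ENNReal.ofReal (N (T x - ψ θ) ^ 2) ∂(P θ) ≤ R) (hRtop : R ≠ ∞)
    {v : Vec k} {K : ℝ} (hK : ∀ x, |inner ℝ v x| ≤ K * N x) :
    HasBoundedRisk P Θ₀ (fun x => inner ℝ v (T x)) (K ^ 2 * R.toReal) := by
  intro θ hθ
  have := hP θ hθ
  have hmeas : Measurable fun x => N (T x - ψ θ) ^ 2 :=
    ((continuous_seminorm N).measurable.comp (hT.sub_const _)).pow_const 2
  have hlt : ∫⁻ x, ENNReal.ofReal (N (T x - ψ θ) ^ 2) ∂(P θ) < ∞ :=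
    (hR θ hθ).trans_lt hRtop.lt_top
  have hint : Integrable (fun x => N (T x - ψ θ) ^ 2) (P θ) :=
    ⟨hmeas.aestronglyMeasurable, (hasFiniteIntegral_iff_ofReal
      (Eventually.of_forall fun x => sq_nonneg _)).2 hlt⟩
  have hle : ∀ x, (inner ℝ v (T x) - inner ℝ v (ψ θ)) ^ 2 ≤ K ^ 2 * N (T x - ψ θ) ^ 2 := by
    intro x
    rw [← inner_sub_right, ← mul_pow]
    exact sq_le_sq' (by linarith [(abs_le.1 (hK (T x - ψ θ))).1]) (abs_le.1 (hK (T x - ψ θ))).2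
  have hSm : Measurable fun x => inner ℝ v (T x) :=
    (continuous_const.inner continuous_id).measurable.comp hT
  have hint' : Integrable (fun x => (inner ℝ v (T x) - inner ℝ v (ψ θ)) ^ 2) (P θ) := by
    refine (hint.const_mul (K ^ 2)).mono' ((hSm.sub_const _).pow_const 2).aestronglyMeasurable
      (Eventually.of_forall fun x => ?_)
    rw [Real.norm_of_nonneg (sq_nonneg _)]
    exact hle x
  refine ⟨inner ℝ v (ψ θ), hint', (integral_mono hint' (hint.const_mul _) hle).trans ?_⟩
  rw [integral_const_mul, integral_eq_lintegral_of_nonneg_ae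
    (Eventually.of_forall fun x => sq_nonneg _) hmeas.aestronglyMeasurable]
  gcongr
  exact hR θ hθ

/-- The constant `K` is kept general: directions in the dual unit ball have `K = 1`, while
coordinate directions, used for integration by parts, have some finite `K`. -/
theorem ofReal_integral_inner_sq_le (M : IsHellingerModel ν Θ₀ P ξ)
    (hT : Measurable T)
    (hR : ∀ θ ∈ Θ₀, ∫⁻ x, ENNReal.ofReal (N (T x - ψ θ) ^ 2) ∂(P θ) ≤ R)
    {v : Vec k} {K : ℝ} (hK : ∀ x, |inner ℝ v x| ≤ K * N x) {t : Vec d} (ht : t ∈ Θ₀) :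
    ENNReal.ofReal (∫ x, (inner ℝ v (T x) - inner ℝ v (φ t)) ^ 2 ∂(P t)) ≤
      ENNReal.ofReal (K ^ 2) * (R ^ (1 / 2 : ℝ) + ENNReal.ofReal (N (ψ t - φ t))) ^ 2 := by
  have := M.isProbabilityMeasure t ht
  have hSm : Measurable fun x => inner ℝ v (T x) :=
    (continuous_const.inner continuous_id).measurable.comp hT
  rw [integral_eq_lintegral_of_nonneg_ae (Eventually.of_forall fun x => sq_nonneg _)
    ((hSm.sub_const _).pow_const 2).aestronglyMeasurable]
  refine ENNReal.ofReal_toReal_le.trans ?_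
  refine le_trans ?_ (mul_le_mul_right (lintegral_seminorm_sub_sq_le (b := φ t) hT (hR t ht)) _)
  rw [← lintegral_const_mul' _ _ ENNReal.ofReal_ne_top]
  refine lintegral_mono fun x => ?_
  rw [← ENNReal.ofReal_mul (sq_nonneg _), ← inner_sub_right, ← mul_pow]
  refine ENNReal.ofReal_le_ofReal ?_
  exact sq_le_sq' (by linarith [(abs_le.1 (hK (T x - φ t))).1]) (abs_le.1 (hK (T x - φ t))).2

variable [SigmaFinite ν]

/-- Expanding the square leaves `E_t S²`, `E_t S` and `g t`, each measurable in `t`; joint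
measurability in `(x, t)` is not needed. -/
theorem aestronglyMeasurable_surrogate_risk (M : IsHellingerModel ν Θ₀ P ξ)
    (h : IsNicePrior Θ₀ (fun t => fisherInfo ν (ξ t)) φ Q q) {S : 𝓧 → ℝ} {g : Vec d → ℝ} {C : ℝ}
    (hS : Measurable S) (hR : HasBoundedRisk P Θ₀ S C) (hg : Integrable g Q) :
    AEStronglyMeasurable (fun t => ∫ x, (S x - g t) ^ 2 ∂(P t)) Q := by
  have h2 : ∀ θ ∈ Θ₀, MemLp S 2 (P θ) := fun θ hθ => M.memLp_of_hasBoundedRisk hS hR hθ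
  have hi : ∀ θ ∈ Θ₀, Integrable S (P θ) := fun θ hθ => by
    have := M.isProbabilityMeasure θ hθ
    exact (h2 θ hθ).integrable one_le_two
  have hm1 := (aestronglyMeasurable_of_measurable_indicator M.isOpen
    (M.measurable_integral hS hi)).mono_ac h.absolutelyContinuous
  have hm2 := (aestronglyMeasurable_of_measurable_indicator M.isOpen
    (M.measurable_integral (hS.pow_const 2) fun θ hθ => (h2 θ hθ).integrable_sq)).mono_ac
      h.absolutelyContinuous
  refine ((hm2.sub ((hg.1.mul hm1).const_mul 2)).add (hg.1.pow 2)).congr ?_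
  filter_upwards [h.ae_mem M.isOpen] with t ht
  have := M.isProbabilityMeasure t ht
  have e : ∀ x, (S x - g t) ^ 2 = S x ^ 2 - 2 * g t * S x + g t ^ 2 := fun x => by ring
  have i1 : Integrable (fun x => S x ^ 2 - 2 * g t * S x) (P t) :=
    (h2 t ht).integrable_sq.sub ((hi t ht).const_mul _)
  simp only [e]
  rw [integral_add i1 (integrable_const _), integral_sub (h2 t ht).integrable_sq
    ((hi t ht).const_mul _), integral_const_mul, integral_const, probReal_univ, one_smul]
  simp only [Pi.add_apply, Pi.sub_apply, Pi.mul_apply, Pi.pow_apply]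
  ring

theorem integrable_surrogate_risk (M : IsHellingerModel ν Θ₀ P ξ)
    (h : IsNicePrior Θ₀ (fun t => fisherInfo ν (ξ t)) φ Q q)
    (hψ : AEMeasurable ψ (volume.restrict Θ₀)) (hT : Measurable T)
    (hR : ∀ θ ∈ Θ₀, ∫⁻ x, ENNReal.ofReal (N (T x - ψ θ) ^ 2) ∂(P θ) ≤ R) (hRtop : R ≠ ∞)
    (hbias : approxBias N ψ φ Q ≠ ∞)
    {v : Vec k} {K : ℝ} (hK : ∀ x, |inner ℝ v x| ≤ K * N x) :
    Integrable (fun t => ∫ x, (inner ℝ v (T x) - inner ℝ v (φ t)) ^ 2 ∂(P t)) Q ∧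
    ENNReal.ofReal (∫ t, ∫ x, (inner ℝ v (T x) - inner ℝ v (φ t)) ^ 2 ∂(P t) ∂Q) ≤
      ENNReal.ofReal (K ^ 2) * (R ^ (1 / 2 : ℝ) + approxBias N ψ φ Q) ^ 2 := by
  have := h.isProbabilityMeasure
  have hSm : Measurable fun x => inner ℝ v (T x) :=
    (continuous_const.inner continuous_id).measurable.comp hT
  have hm := aestronglyMeasurable_surrogate_risk M h hSm
    (hasBoundedRisk_inner M.isProbabilityMeasure hT hR hRtop hK) (h.integrable_surrogate.const_inner v)
  have hnn : ∀ t, 0 ≤ ∫ x, (inner ℝ v (T x) - inner ℝ v (φ t)) ^ 2 ∂(P t) := fun t =>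
    integral_nonneg fun x => sq_nonneg _
  have hle : ∫⁻ t, ENNReal.ofReal (∫ x, (inner ℝ v (T x) - inner ℝ v (φ t)) ^ 2 ∂(P t)) ∂Q ≤
      ENNReal.ofReal (K ^ 2) * (R ^ (1 / 2 : ℝ) + approxBias N ψ φ Q) ^ 2 := by
    refine le_trans ?_ (mul_le_mul_right (lintegral_surrogate_risk_le
      (hψ.mono_ac h.absolutelyContinuous) h.integrable_surrogate.1.aemeasurable) _)
    rw [← lintegral_const_mul' _ _ ENNReal.ofReal_ne_top]
    refine lintegral_mono_ae ?_
    filter_upwards [h.ae_mem M.isOpen] with t ht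
    exact ofReal_integral_inner_sq_le M hT hR hK ht
  have hfin : ENNReal.ofReal (K ^ 2) * (R ^ (1 / 2 : ℝ) + approxBias N ψ φ Q) ^ 2 < ∞ :=
    ENNReal.mul_lt_top ENNReal.ofReal_lt_top (ENNReal.pow_lt_top (ENNReal.add_lt_top.2
      ⟨ENNReal.rpow_lt_top_of_nonneg (by norm_num) hRtop, hbias.lt_top⟩))
  have hint : Integrable (fun t => ∫ x, (inner ℝ v (T x) - inner ℝ v (φ t)) ^ 2 ∂(P t)) Q :=
    ⟨hm, (hasFiniteIntegral_iff_ofReal (Eventually.of_forall hnn)).2 (hle.trans_lt hfin)⟩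
  refine ⟨hint, ?_⟩
  rw [ofReal_integral_eq_lintegral_ofReal hint (Eventually.of_forall hnn)]
  exact hle

end SurrogateRisk

/-! ### Matrix square roots and inverses. -/

section Matrices

variable {k : ℕ}

theorem norm_sqrt_mulVec_sq {G : Matrix (Fin k) (Fin k) ℝ} (hG : G.PosSemidef) (u : Vec k) :
    ‖(WithLp.toLp 2 (CFC.sqrt G *ᵥ u.ofLp) : Vec k)‖ ^ 2 = u.ofLp ⬝ᵥ G *ᵥ u.ofLp := by
  have h1 : CFC.sqrt G * CFC.sqrt G = G := CFC.sqrt_mul_sqrt_self G hG.nonneg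
  have h2 : (CFC.sqrt G)ᵀ = CFC.sqrt G := by
    have : (CFC.sqrt G).IsHermitian := (CFC.sqrt_nonneg G).isSelfAdjoint
    rwa [Matrix.IsHermitian, Matrix.conjTranspose_eq_transpose_of_trivial] at this
  rw [EuclideanSpace.real_norm_sq_eq]
  conv_rhs => rw [← h1, ← Matrix.mulVec_mulVec, Matrix.dotProduct_mulVec, ← Matrix.mulVec_transpose,
    h2]
  simp only [dotProduct, sq]

/-- If the quadratic form of `J` dominates the linear form `2 w` up to the constant `V`, then
`V` is at least the value `w ⬝ᵥ J⁻¹ *ᵥ w` of the dual form. -/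
theorem dotProduct_inv_mulVec_le {d : ℕ} {J : Matrix (Fin d) (Fin d) ℝ} (hJ : J.PosDef)
    {w : Fin d → ℝ} {V : ℝ} (h : ∀ c, 2 * (c ⬝ᵥ w) ≤ V + c ⬝ᵥ J *ᵥ c) : w ⬝ᵥ J⁻¹ *ᵥ w ≤ V := by
  -- The maximiser of `2 cᵀw - cᵀJc`.
  have h1 := h (J⁻¹ *ᵥ w)
  rw [Matrix.mulVec_mulVec, Matrix.mul_nonsing_inv _ ((Matrix.isUnit_iff_isUnit_det _).1 hJ.isUnit),
    Matrix.one_mulVec, dotProduct_comm] at h1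
  linarith

end Matrices

/-! ### The bound in one direction `u`. -/

section LowerBound

variable {d k : ℕ} {𝓧 : Type*} [MeasurableSpace 𝓧] {ν : Measure 𝓧} [SigmaFinite ν]
  {Θ₀ : Set (Vec d)} {P : Vec d → Measure 𝓧} {ξ : Vec d → 𝓧 → Vec d}
  {ψ φ : Vec d → Vec k} {Q : Measure (Vec d)} {q : Vec d → ℝ}
  {N : Seminorm ℝ (Vec k)} {T : 𝓧 → Vec k} {R : ℝ≥0∞}

theorem posSemidef_meanInfo (M : IsHellingerModel ν Θ₀ P ξ)
    (h : IsNicePrior Θ₀ (fun t => fisherInfo ν (ξ t)) φ Q q) :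
    (meanInfo (fun t => fisherInfo ν (ξ t)) Q).PosSemidef := by
  refine Matrix.PosSemidef.of_dotProduct_mulVec_nonneg ?_ fun c => ?_
  · ext i j
    simp only [Matrix.conjTranspose_apply, meanInfo, fisherInfo, Matrix.of_apply, star_trivial,
      mul_comm]
  · rw [star_trivial, (dotProduct_meanInfo_mulVec (M.integrable_fisherInfo h) c).2]
    refine integral_nonneg_of_ae ?_
    filter_upwards [h.ae_mem M.isOpen] with t ht
    rw [dotProduct_fisherInfo_mulVec (M.hasHellingerDerivAt t ht).1 c]
    exact mul_nonneg (by norm_num) (integral_nonneg fun x => sq_nonneg _)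

theorem posDef_priorFisherInfo_add_meanInfo (M : IsHellingerModel ν Θ₀ P ξ)
    (h : IsNicePrior Θ₀ (fun t => fisherInfo ν (ξ t)) φ Q q) :
    (priorFisherInfo Θ₀ q + meanInfo (fun t => fisherInfo ν (ξ t)) Q).PosDef :=
  h.posDef_priorFisherInfo.add_posSemidef (posSemidef_meanInfo M h)

theorem posSemidef_vanTreesMatrix (M : IsHellingerModel ν Θ₀ P ξ)
    (h : IsNicePrior Θ₀ (fun t => fisherInfo ν (ξ t)) φ Q q) :
    (vanTreesMatrix Θ₀ (fun t => fisherInfo ν (ξ t)) φ Q q).PosSemidef := by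
  have := (posDef_priorFisherInfo_add_meanInfo M h).inv.posSemidef.conjTranspose_mul_mul_same
    (meanGrad φ Q)
  rwa [Matrix.conjTranspose_eq_transpose_of_trivial] at this

theorem dotProduct_vanTreesMatrix_mulVec (I : Vec d → Matrix (Fin d) (Fin d) ℝ) (u : Fin k → ℝ) :
    u ⬝ᵥ vanTreesMatrix Θ₀ I φ Q q *ᵥ u =
      (meanGrad φ Q *ᵥ u) ⬝ᵥ (priorFisherInfo Θ₀ q + meanInfo I Q)⁻¹ *ᵥ (meanGrad φ Q *ᵥ u) := by
  rw [vanTreesMatrix, ← Matrix.mulVec_mulVec, ← Matrix.mulVec_mulVec, Matrix.dotProduct_mulVec,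
    Matrix.vecMul_transpose]

/-- The flux of a linear form of an estimator is the linear combination of the coordinate fluxes. -/
theorem biasFlux_inner (M : IsHellingerModel ν Θ₀ P ξ) (hT : Measurable T)
    (hT2 : ∀ j, ∀ θ ∈ Θ₀, MemLp (fun x => T x j) 2 (P θ)) (u : Vec k) (i : Fin d)
    {t : Vec d} (ht : t ∈ Θ₀) :
    biasFlux P ν ξ q (fun x => inner ℝ u (T x)) (fun t => inner ℝ u (φ t)) i t =
      ∑ j, u j * biasFlux P ν ξ q (fun x => T x j) (fun t => φ t j) i t := by
  have := M.isProbabilityMeasure t ht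
  have hinner : ∀ x : Vec k, inner ℝ u x = ∑ j, u j * x j := fun x => by
    rw [PiLp.inner_apply]
    exact Finset.sum_congr rfl fun j _ => by simp [mul_comm]
  have hTj : ∀ j, Measurable fun x => T x j := fun j =>
    (EuclideanSpace.proj j : Vec k →L[ℝ] ℝ).continuous.measurable.comp hT
  have e1 : ∫ x, inner ℝ u (T x) ∂(P t) = ∑ j, u j * ∫ x, T x j ∂(P t) := by
    simp only [hinner, ← integral_const_mul]
    exact integral_finsetSum _ fun j _ => ((hT2 j t ht).integrable one_le_two).const_mul _
  have e2 : ∫ x, inner ℝ u (T x) * sqrtDensity P ν t x * inner ℝ (basisVec i) (ξ t x) ∂ν =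
      ∑ j, u j * ∫ x, T x j * sqrtDensity P ν t x * inner ℝ (basisVec i) (ξ t x) ∂ν := by
    simp only [← integral_const_mul]
    rw [← integral_finsetSum]
    · congr 1
      ext x
      rw [hinner, Finset.sum_mul, Finset.sum_mul]
      exact Finset.sum_congr rfl fun j _ => by ring
    · exact fun j _ => ((M.memLp_mul_sqrtDensity ht (hTj j) (hT2 j t ht).integrable_sq).integrable_mul
        (M.memLp_inner_score ht (basisVec i))).const_mul _
  simp only [biasFlux]
  rw [e1, e2, hinner, Finset.mul_sum, Finset.sum_mul, ← Finset.sum_sub_distrib, Finset.sum_mul,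
    ← Finset.sum_add_distrib]
  exact Finset.sum_congr rfl fun j _ => by ring

/-- Integration by parts is done for each coordinate of `φ` and then combined. Line derivatives are
additive only where they exist, whereas the flux, which contains no derivative of `g`, is linear in
`(S, g)` at every point of `Θ₀`. -/
theorem integral_biasFlux_inner (M : IsHellingerModel ν Θ₀ P ξ)
    (h : IsNicePrior Θ₀ (fun t => fisherInfo ν (ξ t)) φ Q q) (hN : ∀ v, N v = 0 → v = 0)
    (hψ : AEMeasurable ψ (volume.restrict Θ₀)) (hφ : ∀ j, IsAbsCont Θ₀ fun t => φ t j)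
    (hT : Measurable T)
    (hR : ∀ θ ∈ Θ₀, ∫⁻ x, ENNReal.ofReal (N (T x - ψ θ) ^ 2) ∂(P θ) ≤ R) (hRtop : R ≠ ∞)
    (hbias : approxBias N ψ φ Q ≠ ∞) (u : Vec k) (i : Fin d) :
    IntegrableOn (fun t => biasFlux P ν ξ q (fun x => inner ℝ u (T x))
      (fun t => inner ℝ u (φ t)) i t) Θ₀ ∧
    (meanGrad φ Q *ᵥ u.ofLp) i = ∫ t in Θ₀, biasFlux P ν ξ q (fun x => inner ℝ u (T x))
      (fun t => inner ℝ u (φ t)) i t := by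
  have hTj : ∀ j, Measurable fun x => T x j := fun j =>
    (EuclideanSpace.proj j : Vec k →L[ℝ] ℝ).continuous.measurable.comp hT
  choose K _ hK using fun j : Fin k => exists_abs_inner_le hN (basisVec j)
  have hB : ∀ j, HasBoundedRisk P Θ₀ (fun x => T x j) (K j ^ 2 * R.toReal) := fun j => by
    have := hasBoundedRisk_inner M.isProbabilityMeasure hT hR hRtop (hK j)
    simpa only [inner_basisVec] using this
  have hflux : ∀ j, IntegrableOn (fun t => biasFlux P ν ξ q (fun x => T x j)
      (fun t => φ t j) i t) Θ₀ ∧ ∫ t, partialDeriv (fun t => φ t j) i t ∂Q =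
        ∫ t in Θ₀, biasFlux P ν ξ q (fun x => T x j) (fun t => φ t j) i t := fun j => by
    have hV := (integrable_surrogate_risk M h hψ hT hR hRtop hbias (hK j)).1
    have hφQ := h.integrable_surrogate.const_inner (𝕜 := ℝ) (basisVec j)
    simp only [inner_basisVec] at hV hφQ
    exact integral_partialDeriv_eq M h (hTj j) (hB j) (hφ j) hφQ i (h.integrable_gradMatrix i j) hV
  have e : ∀ t ∈ Θ₀, ∑ j, u j * biasFlux P ν ξ q (fun x => T x j) (fun t => φ t j) i t =
      biasFlux P ν ξ q (fun x => inner ℝ u (T x)) (fun t => inner ℝ u (φ t)) i t := fun t ht =>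
    (biasFlux_inner M hT (fun j _ hθ => M.memLp_of_hasBoundedRisk (hTj j) (hB j) hθ) u i ht).symm
  have hint : ∀ j, IntegrableOn (fun t => u j * biasFlux P ν ξ q (fun x => T x j)
      (fun t => φ t j) i t) Θ₀ := fun j => (hflux j).1.const_mul _
  refine ⟨(integrableOn_congr_fun e M.isOpen.measurableSet).1
    (integrable_finsetSum _ fun j _ => hint j), ?_⟩
  rw [← setIntegral_congr_fun M.isOpen.measurableSet e, integral_finsetSum _ fun j _ => hint j]
  simp only [Matrix.mulVec, dotProduct]
  refine Finset.sum_congr rfl fun j _ => ?_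
  rw [integral_const_mul, ← (hflux j).2, mul_comm]
  rfl

/-- The van Trees inequality for an estimator of bounded risk, in one direction. -/
theorem ofReal_norm_sqrt_mulVec_le (M : IsHellingerModel ν Θ₀ P ξ)
    (h : IsNicePrior Θ₀ (fun t => fisherInfo ν (ξ t)) φ Q q) (hN : ∀ v, N v = 0 → v = 0)
    (hψ : AEMeasurable ψ (volume.restrict Θ₀)) (hφ : ∀ j, IsAbsCont Θ₀ fun t => φ t j)
    (hT : Measurable T)
    (hR : ∀ θ ∈ Θ₀, ∫⁻ x, ENNReal.ofReal (N (T x - ψ θ) ^ 2) ∂(P θ) ≤ R) (hRtop : R ≠ ∞)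
    (hbias : approxBias N ψ φ Q ≠ ∞) {u : Vec k} (hu : dualNorm N u ≤ 1) :
    ENNReal.ofReal ‖(WithLp.toLp 2 (CFC.sqrt
      (vanTreesMatrix Θ₀ (fun t => fisherInfo ν (ξ t)) φ Q q) *ᵥ u.ofLp) : Vec k)‖ ≤
      R ^ (1 / 2 : ℝ) + approxBias N ψ φ Q := by
  have hK : ∀ x, |inner ℝ u x| ≤ 1 * N x := fun x => by
    rw [one_mul]
    exact abs_inner_le_of_dualNorm_le_one hN hu x
  obtain ⟨hV, hVle⟩ := integrable_surrogate_risk M h hψ hT hR hRtop hbias hK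
  have hS : Measurable fun x => inner ℝ u (T x) :=
    (continuous_const.inner continuous_id).measurable.comp hT
  have h1 := dotProduct_inv_mulVec_le (posDef_priorFisherInfo_add_meanInfo M h)
    (two_mul_dotProduct_le M h hS (hasBoundedRisk_inner M.isProbabilityMeasure hT hR hRtop hK) hV
      (integral_biasFlux_inner M h hN hψ hφ hT hR hRtop hbias u))
  rw [← dotProduct_vanTreesMatrix_mulVec,
    ← norm_sqrt_mulVec_sq (posSemidef_vanTreesMatrix M h)] at h1
  refine (ENNReal.pow_le_pow_left_iff two_ne_zero).1 ?_
  rw [← ENNReal.ofReal_pow (norm_nonneg _)]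
  refine (ENNReal.ofReal_le_ofReal h1).trans ?_
  simpa only [one_pow, ENNReal.ofReal_one, one_mul] using hVle

end LowerBound

end SurrogateVanTrees

/-- Minimax lower bound via absolutely continuous surrogates. The subtraction is the truncated one
of `[0, ∞]`, so that `(a - b) ^ 2` is `[a - b]₊²`. -/
theorem mainTheorem3 {d k : ℕ} {𝓧 : Type*} [MeasurableSpace 𝓧] (ν : Measure 𝓧) [SigmaFinite ν]
    (Θ₀ : Set (SurrogateVanTrees.Vec d)) (hΘ₀ : IsOpen Θ₀)
    (P : SurrogateVanTrees.Vec d → Measure 𝓧)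
    (hP : ∀ θ ∈ Θ₀, IsProbabilityMeasure (P θ)) (hPν : ∀ θ ∈ Θ₀, P θ ≪ ν)
    (ξ : SurrogateVanTrees.Vec d → 𝓧 → SurrogateVanTrees.Vec d)
    (hξ : ∀ θ ∈ Θ₀, SurrogateVanTrees.HasHellingerDerivAt P ν θ (ξ θ))
    (N : Seminorm ℝ (SurrogateVanTrees.Vec k)) (hN : ∀ v, N v = 0 → v = 0)
    (ψ φ : SurrogateVanTrees.Vec d → SurrogateVanTrees.Vec k)
    (hψ : AEMeasurable ψ (volume.restrict Θ₀))
    (hφ : ∀ j : Fin k, SurrogateVanTrees.IsAbsCont Θ₀ fun t => φ t j) :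
    ⨆ (Q : Measure (SurrogateVanTrees.Vec d)) (q : SurrogateVanTrees.Vec d → ℝ)
      (_ : SurrogateVanTrees.IsNicePrior Θ₀
        (fun t => SurrogateVanTrees.fisherInfo ν (ξ t)) φ Q q),
      (SurrogateVanTrees.surrogateEfficiency N
          (SurrogateVanTrees.vanTreesMatrix Θ₀
            (fun t => SurrogateVanTrees.fisherInfo ν (ξ t)) φ Q q)
        - SurrogateVanTrees.approxBias N ψ φ Q) ^ 2
      ≤ SurrogateVanTrees.minimaxRisk P Θ₀ N ψ := by
  refine iSup_le fun Q => iSup_le fun q => iSup_le fun h => le_iInf fun T => le_iInf fun hT => ?_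
  set R := ⨆ θ ∈ Θ₀, ∫⁻ x, ENNReal.ofReal (N (T x - ψ θ) ^ 2) ∂(P θ) with hRdef
  have hR : ∀ θ ∈ Θ₀, ∫⁻ x, ENNReal.ofReal (N (T x - ψ θ) ^ 2) ∂(P θ) ≤ R := fun θ hθ =>
    le_iSup₂_of_le θ hθ le_rfl
  -- Infinite risk makes the bound trivial, and infinite bias makes the truncated difference zero.
  rcases eq_or_ne R ∞ with hRtop | hRtop
  · rw [hRtop]; exact le_top
  rcases eq_or_ne (SurrogateVanTrees.approxBias N ψ φ Q) ∞ with hbias | hbias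
  · rw [hbias, ENNReal.sub_top]; simp
  rw [← SurrogateVanTrees.rpow_half_sq R]
  gcongr
  -- With the bias moved to the right, the supremum over `u` is bounded one direction at a time.
  rw [tsub_le_iff_right]
  exact iSup₂_le fun u hu => SurrogateVanTrees.ofReal_norm_sqrt_mulVec_le
    ⟨hΘ₀, hP, hPν, hξ⟩ h hN hψ hφ hT hR hRtop hbias hu
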